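/- Fix an alphabet $\Sigma$ (finite or infinite). **Ipomsets.** A labelled iposet $(P,<,\dashrightarrow,S,T,\lambda)$ is a finite set $P$ with two strict partial orders, the precedence order $<$ and the event order $\dashrightarrow$, such that any two distinct elements are comparable by $<$ or by $\dashrightarrow$, a labelling $\lambda:P\to\Sigma$, and sets $S,T\subseteq P$ (source and target interface) of $<$-minimal, respectively $<$-maximal, elements. A subsumption $P\to Q$ is a label-preserving bijection $f$ with $f(S_P)=S_Q$, $f(T_P)=T_Q$, such that $f(x)<_Q f(y)$ implies $x<_P y$, and such that $x\dashrightarrow_P y$ implies $f(x)\dashrightarrow_Q f(y)$ for $<_P$-incomparable $x,y$; we write $P\sqsubseteq Q$ if one exists. An isomorphism is a subsumption that also preserves $<$ (so only the event order of $<$-incomparable elements matters up to isomorphism). An ipomset is an isomorphism class of labelled iposets; it is an interval ipomset if there are $b,e:P\to\mathbb R$ with $b\le e$ and $x<y\iff e(x)<b(y)$. For finite totally ordered labelled sets (lo-sets) write $\simeq$ for isomorphism. If $T_P\simeq S_Q$ (as lo-sets ordered by $\dashrightarrow$), the gluing $P*Q$ is the quotient of $P\sqcup Q$ identifying $T_P$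 with $S_Q$ along the unique isomorphism, with interfaces $S_P$ and $T_Q$, event order the transitive closure of $\dashrightarrow_P\cup\dashrightarrow_Q$, and $x<y$ iff $x<_Py$, or $x<_Qy$, or $x\in P\setminus T_P$ and $y\in Q\setminus S_Q$. **Languages.** A language is a set $L$ of interval ipomsets such that $P\sqsubseteq Q\in L$ implies $P\in L$ for interval ipomsets $P$. Put $L*M=\{R \text{ an interval ipomset}\mid R\sqsubseteq P*Q \text{ for some } P\in L,\ Q\in M \text{ with } T_P\simeq S_Q\}$, $L^1=L$, $L^{n+1}=L*L^n$; the Kleene plus of $L$ is $L^+=\bigcup_{n\ge1}L^n$. **HDAs.** Let $\square$ be the category whose objects are the words over $\Sigma$ (isomorphism classes of lo-sets), and whose morphisms $d_{A,B}:U\to V$ are given by disjoint sets $A,B$ of events of $V$ together with an order- and label-preserving map $\partial:U\to V$ with image $V\setminus(A\cup B)$; the composite of $d_{A,B}:U\to V$ with $d_{C,D}:V\to W$, whose underlying map is $\partial'$, is $d_{\partial'(A)\cup C,\,\partial'(B)\cup D}$. A higher-dimensional automaton (HDA) is a presheaf $X:\square^{\mathrm{op}}\to\mathrm{Set}$ with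 finitely many cells (elements of the sets $X[U]$), together with arbitrary sets of start cells and of accept cells. A path in $X$ is a sequence of cells $x_0,\dots,x_n$ ($n\ge 0$) joined by up-steps from $\delta^0_A(x)=X[d_{A,\emptyset}](x)$ to $x$ and down-steps from $x$ to $\delta^1_B(x)=X[d_{\emptyset,B}](x)$. For $x\in X[U]$, the ipomset of an up-step $\delta^0_A(x)\to x$ is the discrete ipomset $U$ (empty $<$) with $S=U\setminus A$, $T=U$; that of a down-step $x\to\delta^1_B(x)$ is the discrete ipomset $U$ with $S=U$, $T=U\setminus B$; the path of length $0$ at $x$ has the discrete ipomset $U$ with $S=T=U$; the ipomset of a path of positive length is the gluing of the ipomsets of its steps. A set of ipomsets is regular if it is the set of ipomsets of all paths of some HDA that lead from a start cell to an accept cell. **Proposition.** If $L$ is regular, then its Kleene plus $L^+$ is a language, and it is regular. -/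

import Mathlib

open CategoryTheory Opposite

universe u

namespace HDALang

/-! ### Lo-sets and the labelled precube category -/

/-- A lo-set up to isomorphism, that is, a word over the alphabet `α`: the events are the elements
of `Fin size`, the event order is the order of `Fin size`. -/
structure LoSet (α : Type u) where
  size : ℕ
  label : Fin size → α

/-- A coface map `d_{A,B} : U → V`: an order and label preserving map whose image is the
complement of `A ∪ B`, for disjoint sets `A` (events unstarted in `U`) and `B` (events terminated
in `U`) of events of `V`. -/
@[ext]
structure Coface {α : Type u} (U V : LoSet α) where
  map : Fin U.size ↪o Fin V.size
  A : Set (Fin V.size)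
  B : Set (Fin V.size)
  label_map : ∀ i, V.label (map i) = U.label i
  disjoint : Disjoint A B
  compl_range : (Set.range map)ᶜ = A ∪ B

namespace Coface

variable {α : Type u}

/-- The identity `d_{∅,∅}`. -/
def id (U : LoSet α) : Coface U U where
  map := RelEmbedding.refl _
  A := ∅
  B := ∅
  label_map _ := rfl
  disjoint := by simp
  compl_range := by ext; simp

/-- `d_{C,D} ∘ d_{A,B} = d_{∂(A) ∪ C, ∂(B) ∪ D}`, where `∂` is the map underlying `d_{C,D}`. -/
def comp {U V W : LoSet α} (d : Coface U V) (e : Coface V W) : Coface U W where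
  map := d.map.trans e.map
  A := e.map '' d.A ∪ e.A
  B := e.map '' d.B ∪ e.B
  label_map i := by simp [e.label_map, d.label_map]
  disjoint := by
    have hd := d.disjoint
    have he := e.disjoint
    have hr : ∀ i, e.map i ∉ e.A ∪ e.B := fun i hi => by
      rw [← e.compl_range] at hi
      exact hi ⟨i, rfl⟩
    rw [Set.disjoint_left] at *
    rintro x (⟨a, ha, rfl⟩ | ha) (⟨b, hb, hab⟩ | hb)
    · rw [e.map.injective hab] at hb
      exact hd ha hb
    · exact hr a (Or.inr hb)
    · subst hab
      exact hr b (Or.inl ha)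
    · exact he ha hb
  compl_range := by
    ext x
    have hd := fun y => Set.ext_iff.1 d.compl_range y
    have he := Set.ext_iff.1 e.compl_range x
    simp only [Set.mem_compl_iff, Set.mem_range, Set.mem_union, Set.mem_image,
      RelEmbedding.coe_trans, Function.comp_apply, not_exists] at *
    constructor
    · intro h
      by_cases hx : ∃ y, e.map y = x
      · obtain ⟨y, rfl⟩ := hx
        have : y ∈ d.A ∨ y ∈ d.B := (hd y).1 fun z hz => h z (by rw [hz])
        rcases this with h | h
        · exact Or.inl (Or.inl ⟨y, h, rfl⟩)
        · exact Or.inr (Or.inl ⟨y, h, rfl⟩)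
      · push Not at hx
        rcases he.1 hx with h | h
        · exact Or.inl (Or.inr h)
        · exact Or.inr (Or.inr h)
    · intro h z hz
      have key : ∀ y, (y ∈ d.A ∨ y ∈ d.B) → e.map y = x → False := fun y hy hyx => by
        rw [← hz] at hyx
        exact (hd y).2 hy z (e.map.injective hyx).symm
      have key' : (x ∈ e.A ∨ x ∈ e.B) → False := fun h => he.2 h _ hz
      rcases h with (⟨y, hy, hyx⟩ | h) | (⟨y, hy, hyx⟩ | h)
      · exact key y (Or.inl hy) hyx
      · exact key' (Or.inl h)
      · exact key y (Or.inr hy) hyx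
      · exact key' (Or.inr h)

end Coface

/-- The (skeletal) labelled precube category. -/
instance {α : Type u} : Category.{0} (LoSet α) where
  Hom U V := Coface U V
  id U := Coface.id U
  comp d e := Coface.comp d e
  id_comp d := by
    apply Coface.ext <;> simp [Coface.comp, Coface.id]
  comp_id d := by
    apply Coface.ext <;> simp [Coface.comp, Coface.id]
  assoc d e f := by
    apply Coface.ext
    · rfl
    · simp [Coface.comp, Set.image_union, Set.image_image, Set.union_assoc]
    · simp [Coface.comp, Set.image_union, Set.image_image, Set.union_assoc]

/-! ### Higher-dimensional automata -/

/-- A precubical set. -/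
abbrev PrecubicalSet (α : Type u) := (LoSet α)ᵒᵖ ⥤ Type

/-- The cells of a precubical set. -/
abbrev Cell {α : Type u} (X : PrecubicalSet α) := Σ U : LoSet α, X.obj (op U)

/-- A higher-dimensional automaton: a finite precubical set with start and accept cells. -/
structure HDA (α : Type u) where
  cells : PrecubicalSet α
  finite : Finite (Cell cells)
  start : Set (Cell cells)
  accept : Set (Cell cells)

/-! ### Labelled iposets and ipomsets -/

/-- Labelled posets with interfaces `S`, `T`, precedence order `prec` and event order `event`. -/
structure Iposet (α : Type u) where
  carrier : Type
  finite : Finite carrier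
  prec : carrier → carrier → Prop
  event : carrier → carrier → Prop
  S : Set carrier
  T : Set carrier
  label : carrier → α
  prec_irrefl : ∀ x, ¬ prec x x
  prec_trans : ∀ x y z, prec x y → prec y z → prec x z
  event_irrefl : ∀ x, ¬ event x x
  event_trans : ∀ x y z, event x y → event y z → event x z
  comparable : ∀ x y, x = y ∨ prec x y ∨ prec y x ∨ event x y ∨ event y x
  S_minimal : ∀ x ∈ S, ∀ y, ¬ prec y x
  T_maximal : ∀ x ∈ T, ∀ y, ¬ prec x y

namespace Iposet

variable {α : Type u}

/-- `f` is a subsumption of `P` by `Q`. -/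
structure IsSubsumption (P Q : Iposet α) (f : P.carrier ≃ Q.carrier) : Prop where
  src : f '' P.S = Q.S
  tgt : f '' P.T = Q.T
  label : ∀ x, Q.label (f x) = P.label x
  prec : ∀ x y, Q.prec (f x) (f y) → P.prec x y
  event : ∀ x y, P.event x y → ¬ P.prec x y → ¬ P.prec y x → Q.event (f x) (f y)

/-- `P ⊑ Q`: there is a subsumption from `P` to `Q`. -/
def Subsumed (P Q : Iposet α) : Prop := ∃ f, IsSubsumption P Q f

/-- `P ≅ Q`: there is a subsumption that is an isomorphism of precedence orders. By
`comparable`, such a map and its inverse both preserve the event order of concurrent events. -/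
def Isomorphic (P Q : Iposet α) : Prop :=
  ∃ f, IsSubsumption P Q f ∧ ∀ x y, P.prec x y → Q.prec (f x) (f y)

theorem IsSubsumption.trans {P Q R : Iposet α} {f : P.carrier ≃ Q.carrier}
    {g : Q.carrier ≃ R.carrier} (hf : IsSubsumption P Q f) (hg : IsSubsumption Q R g) :
    IsSubsumption P R (f.trans g) where
  src := by rw [← hg.src, ← hf.src, Set.image_image]; rfl
  tgt := by rw [← hg.tgt, ← hf.tgt, Set.image_image]; rfl
  label x := by simp [hg.label, hf.label]
  prec x y h := hf.prec _ _ (hg.prec _ _ h)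
  event x y h h1 h2 := hg.event _ _ (hf.event _ _ h h1 h2)
    (fun h => h1 (hf.prec _ _ h)) (fun h => h2 (hf.prec _ _ h))

theorem Subsumed.trans {P Q R : Iposet α} : P.Subsumed Q → Q.Subsumed R → P.Subsumed R :=
  fun ⟨f, hf⟩ ⟨g, hg⟩ => ⟨f.trans g, hf.trans hg⟩

theorem Isomorphic.subsumed {P Q : Iposet α} (h : P.Isomorphic Q) : P.Subsumed Q :=
  h.imp fun _ hf => hf.1

theorem Isomorphic.symm {P Q : Iposet α} : P.Isomorphic Q → Q.Isomorphic P := by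
  rintro ⟨f, hf, hp⟩
  refine ⟨f.symm, ⟨?_, ?_, fun x => ?_, fun x y h => ?_, fun x y h h1 h2 => ?_⟩, fun x y h => ?_⟩
  · rw [← hf.src, Set.image_image]; simp
  · rw [← hf.tgt, Set.image_image]; simp
  · rw [← hf.label, f.apply_symm_apply]
  · simpa using hp _ _ h
  · obtain ⟨a, rfl⟩ := f.surjective x
    obtain ⟨b, rfl⟩ := f.surjective y
    simp only [f.symm_apply_apply]
    have h1' : ¬ P.prec a b := fun h => h1 (hp _ _ h)
    have h2' : ¬ P.prec b a := fun h => h2 (hp _ _ h)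
    rcases P.comparable a b with e | e | e | e | e
    · subst e
      exact (Q.event_irrefl _ h).elim
    · exact (h1' e).elim
    · exact (h2' e).elim
    · exact e
    · exact (Q.event_irrefl _ (Q.event_trans _ _ _ h (hf.event _ _ e h2' h1'))).elim
  · exact hf.prec _ _ (by simpa using h)

instance isoSetoid (α : Type u) : Setoid (Iposet α) where
  r := Isomorphic
  iseqv :=
    { refl := fun P => ⟨Equiv.refl _, ⟨by simp, by simp, fun _ => rfl, fun _ _ h => h,
        fun _ _ h _ _ => h⟩, fun _ _ h => h⟩
      symm := Isomorphic.symm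
      trans := fun ⟨f, hf, hf'⟩ ⟨g, hg, hg'⟩ =>
        ⟨f.trans g, hf.trans hg, fun _ _ h => hg' _ _ (hf' _ _ h)⟩ }

/-- `P` admits an interval representation. -/
def IsInterval (P : Iposet α) : Prop :=
  ∃ b e : P.carrier → ℝ, (∀ x, b x ≤ e x) ∧ ∀ x y, P.prec x y ↔ e x < b y

theorem Isomorphic.isInterval {P Q : Iposet α} (h : P.Isomorphic Q) (hQ : Q.IsInterval) :
    P.IsInterval := by
  obtain ⟨f, hf, hp⟩ := h
  obtain ⟨b, e, hbe, hQ⟩ := hQ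
  exact ⟨b ∘ f, e ∘ f, fun x => hbe _,
    fun x y => ⟨fun h => (hQ _ _).1 (hp _ _ h), fun h => hf.prec _ _ ((hQ _ _).2 h)⟩⟩

/-! #### Gluing composition -/

/-- An isomorphism of lo-sets from the target interface of `P` to the source interface of `Q`. -/
structure Matching (P Q : Iposet α) where
  equiv : P.T ≃ Q.S
  event_iff : ∀ s t : P.T, P.event s t ↔ Q.event (equiv s) (equiv t)
  label_eq : ∀ t : P.T, Q.label (equiv t) = P.label t

section Glue

variable (P Q : Iposet α) (f : Matching P Q)

/-- The disjoint union of `P` and `Q` with `T_P` and `S_Q` identified along `f`: each class is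
represented by its unique element in `P` or `Q \ S_Q`. -/
abbrev GlueCarrier (P Q : Iposet α) : Type := P.carrier ⊕ {q : Q.carrier // q ∉ Q.S}

variable {P Q}

open Classical in
/-- The structural inclusion of `Q` into the gluing; that of `P` is `Sum.inl`. -/
noncomputable def Matching.inR (q : Q.carrier) : GlueCarrier P Q :=
  if h : q ∈ Q.S then Sum.inl (f.equiv.symm ⟨q, h⟩ : P.T) else Sum.inr ⟨q, h⟩

/-- `x` precedes `y` in the gluing. -/
def Matching.gluePrec (x y : GlueCarrier P Q) : Prop :=
  (∃ a b, P.prec a b ∧ Sum.inl a = x ∧ Sum.inl b = y) ∨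
  (∃ a b, Q.prec a b ∧ f.inR a = x ∧ f.inR b = y) ∨
  (∃ a b, a ∉ P.T ∧ b ∉ Q.S ∧ Sum.inl a = x ∧ f.inR b = y)

/-- The union of the event orders of `P` and `Q`. -/
def Matching.glueEventGen (x y : GlueCarrier P Q) : Prop :=
  (∃ a b, P.event a b ∧ Sum.inl a = x ∧ Sum.inl b = y) ∨
  (∃ a b, Q.event a b ∧ f.inR a = x ∧ f.inR b = y)

theorem Matching.inR_of_notMem {q : Q.carrier} (h : q ∉ Q.S) : f.inR q = Sum.inr ⟨q, h⟩ := by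
  simp [Matching.inR, h]

theorem Matching.inR_equiv (t : P.T) : f.inR (f.equiv t) = Sum.inl (t : P.carrier) := by
  simp [Matching.inR]

theorem Matching.inR_cases (q : Q.carrier) :
    (∃ h : q ∉ Q.S, f.inR q = Sum.inr ⟨q, h⟩) ∨
      ∃ t : P.T, q = f.equiv t ∧ f.inR q = Sum.inl (t : P.carrier) := by
  by_cases h : q ∈ Q.S
  · obtain ⟨t, ht⟩ := f.equiv.surjective ⟨q, h⟩
    have : q = f.equiv t := by rw [ht]
    exact Or.inr ⟨t, this, by rw [this, f.inR_equiv]⟩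
  · exact Or.inl ⟨h, f.inR_of_notMem h⟩

theorem Matching.inR_injective : Function.Injective f.inR := by
  intro p q h
  rcases f.inR_cases p with ⟨hp, ep⟩ | ⟨s, rfl, ep⟩ <;>
    rcases f.inR_cases q with ⟨hq, eq⟩ | ⟨t, rfl, eq⟩ <;> rw [ep, eq] at h
  · simpa using h
  · simp at h
  · simp at h
  · rw [Subtype.ext (Sum.inl_injective h)]

theorem Matching.inR_eq_inl {q : Q.carrier} {p : P.carrier} (h : f.inR q = Sum.inl p) :
    p ∈ P.T ∧ q ∈ Q.S := by
  rcases f.inR_cases q with ⟨hq, eq⟩ | ⟨t, rfl, eq⟩ <;> rw [eq] at h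
  · simp at h
  · rw [← Sum.inl_injective h]
    exact ⟨t.2, (f.equiv t).2⟩

/-- An explicit description of a relation containing the event order of the gluing. -/
def Matching.glueEventAux : GlueCarrier P Q → GlueCarrier P Q → Prop
  | Sum.inl a, Sum.inl b => P.event a b
  | Sum.inr p, Sum.inr q => Q.event p q
  | Sum.inl a, Sum.inr q => ∃ t : P.T, (a = t ∨ P.event a t) ∧ Q.event (f.equiv t) q
  | Sum.inr p, Sum.inl b => ∃ t : P.T, Q.event p (f.equiv t) ∧ ((t : P.carrier) = b ∨ P.event t b)

theorem Matching.glueEventAux_of_gen {x y : GlueCarrier P Q} (h : f.glueEventGen x y) :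
    f.glueEventAux x y := by
  rcases h with ⟨a, b, h, rfl, rfl⟩ | ⟨a, b, h, rfl, rfl⟩
  · exact h
  · rcases f.inR_cases a with ⟨ha, ea⟩ | ⟨s, rfl, ea⟩ <;>
      rcases f.inR_cases b with ⟨hb, eb⟩ | ⟨t, rfl, eb⟩ <;> rw [ea, eb]
    · exact h
    · exact ⟨t, h, Or.inl rfl⟩
    · exact ⟨s, Or.inl rfl, h⟩
    · exact (f.event_iff s t).2 h

theorem Matching.glueEventAux_trans {x y z : GlueCarrier P Q} (h1 : f.glueEventAux x y)
    (h2 : f.glueEventAux y z) : f.glueEventAux x z := by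
  have hP := P.event_trans
  have hQ := Q.event_trans
  have hf := f.event_iff
  have hQT : ∀ s t : P.T, Q.event (f.equiv s) (f.equiv t) → P.event s t :=
    fun s t => (hf s t).2
  have hPT : ∀ s t : P.T, ((s : P.carrier) = t ∨ P.event s t) → ∀ q p,
      Q.event q (f.equiv s) → Q.event (f.equiv t) p → Q.event q p := by
    rintro s t (h | h) q p hq hp
    · rw [Subtype.ext h] at hq
      exact hQ _ _ _ hq hp
    · exact hQ _ _ _ hq (hQ _ _ _ ((hf s t).1 h) hp)
  rcases x with a | p <;> rcases y with b | q <;> rcases z with c | r <;>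
    simp only [Matching.glueEventAux] at h1 h2 ⊢
  · exact hP _ _ _ h1 h2
  · obtain ⟨t, ht, hr⟩ := h2
    refine ⟨t, Or.inr ?_, hr⟩
    rcases ht with rfl | ht
    · exact h1
    · exact hP _ _ _ h1 ht
  · obtain ⟨s, hs, hq⟩ := h1
    obtain ⟨t, hq', ht⟩ := h2
    have hst := hQT _ _ (hQ _ _ _ hq hq')
    have h' : P.event s c := by
      rcases ht with rfl | ht
      · exact hst
      · exact hP _ _ _ hst ht
    rcases hs with rfl | hs
    · exact h'
    · exact hP _ _ _ hs h'
  · obtain ⟨s, hs, hq⟩ := h1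
    exact ⟨s, hs, hQ _ _ _ hq h2⟩
  · obtain ⟨t, hp, ht⟩ := h1
    refine ⟨t, hp, Or.inr ?_⟩
    rcases ht with rfl | ht
    · exact h2
    · exact hP _ _ _ ht h2
  · obtain ⟨s, hp, hs⟩ := h1
    obtain ⟨t, ht, hr⟩ := h2
    refine hPT s t ?_ _ _ hp hr
    rcases hs with hs | hs <;> rcases ht with ht | ht
    · exact Or.inl (hs.trans ht)
    · exact Or.inr (hs ▸ ht)
    · exact Or.inr (ht ▸ hs)
    · exact Or.inr (hP _ _ _ hs ht)
  · obtain ⟨t, hq, ht⟩ := h2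
    exact ⟨t, hQ _ _ _ h1 hq, ht⟩
  · exact hQ _ _ _ h1 h2

theorem Matching.gluePrec_trans {x y z : GlueCarrier P Q} (h1 : f.gluePrec x y)
    (h2 : f.gluePrec y z) : f.gluePrec x z := by
  rcases h1 with ⟨a, b, h1, rfl, e1⟩ | ⟨a, b, h1, rfl, e1⟩ | ⟨a, b, h1, h1', rfl, e1⟩ <;>
    rcases h2 with ⟨c, d, h2, e2, rfl⟩ | ⟨c, d, h2, e2, rfl⟩ | ⟨c, d, h2, h2', e2, rfl⟩ <;>
    have e := e1.trans e2.symm <;> clear e1 e2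
  · cases e
    exact Or.inl ⟨a, d, P.prec_trans _ _ _ h1 h2, rfl, rfl⟩
  · refine Or.inr (Or.inr ⟨a, d, fun ha => P.T_maximal a ha _ h1,
      fun hd => Q.S_minimal d hd _ h2, rfl, rfl⟩)
  · exact Or.inr (Or.inr ⟨a, d, fun ha => P.T_maximal a ha _ h1, h2', rfl, rfl⟩)
  · exact (Q.S_minimal b (f.inR_eq_inl e).2 _ h1).elim
  · cases f.inR_injective e
    exact Or.inr (Or.inl ⟨a, d, Q.prec_trans _ _ _ h1 h2, rfl, rfl⟩)
  · exact (Q.S_minimal b (f.inR_eq_inl e).2 _ h1).elim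
  · exact (h1' (f.inR_eq_inl e).2).elim
  · cases f.inR_injective e
    exact Or.inr (Or.inr ⟨a, d, h1, fun hd => Q.S_minimal d hd _ h2, rfl, rfl⟩)
  · exact (h1' (f.inR_eq_inl e).2).elim

/-- The gluing composition `P * Q` along the isomorphism `f` of `T_P` and `S_Q`. -/
noncomputable def glue (P Q : Iposet α) (f : Matching P Q) : Iposet α where
  carrier := GlueCarrier P Q
  finite := by
    have := P.finite
    have := Q.finite
    infer_instance
  prec := f.gluePrec
  event := Relation.TransGen f.glueEventGen
  S := Sum.inl '' P.S
  T := f.inR '' Q.T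
  label := Sum.elim P.label fun q => Q.label q
  prec_irrefl := by
    rintro x (⟨a, b, h, rfl, e⟩ | ⟨a, b, h, rfl, e⟩ | ⟨a, b, ha, hb, rfl, e⟩)
    · cases e
      exact P.prec_irrefl _ h
    · cases f.inR_injective e
      exact Q.prec_irrefl _ h
    · exact hb (f.inR_eq_inl e).2
  prec_trans _ _ _ h1 h2 := f.gluePrec_trans h1 h2
  event_irrefl := by
    intro x h
    have key : ∀ y, Relation.TransGen f.glueEventGen x y → f.glueEventAux x y := by
      intro y h
      induction h with
      | single h => exact f.glueEventAux_of_gen h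
      | tail _ h ih => exact f.glueEventAux_trans ih (f.glueEventAux_of_gen h)
    have := key x h
    rcases x with a | q
    · exact P.event_irrefl _ this
    · exact Q.event_irrefl _ this
  event_trans _ _ _ h1 h2 := h1.trans h2
  comparable := by
    have hq : ∀ q : {q : Q.carrier // q ∉ Q.S}, f.inR q = Sum.inr q :=
      fun q => f.inR_of_notMem q.2
    have hQ : ∀ p q : Q.carrier, f.inR p = f.inR q ∨ f.gluePrec (f.inR p) (f.inR q) ∨
        f.gluePrec (f.inR q) (f.inR p) ∨
        Relation.TransGen f.glueEventGen (f.inR p) (f.inR q) ∨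
        Relation.TransGen f.glueEventGen (f.inR q) (f.inR p) := by
      intro p q
      rcases Q.comparable p q with e | e | e | e | e
      · exact Or.inl (by rw [e])
      · exact Or.inr (Or.inl (Or.inr (Or.inl ⟨p, q, e, rfl, rfl⟩)))
      · exact Or.inr (Or.inr (Or.inl (Or.inr (Or.inl ⟨q, p, e, rfl, rfl⟩))))
      · exact Or.inr (Or.inr (Or.inr (Or.inl (.single (Or.inr ⟨p, q, e, rfl, rfl⟩)))))
      · exact Or.inr (Or.inr (Or.inr (Or.inr (.single (Or.inr ⟨q, p, e, rfl, rfl⟩)))))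
    rintro (a | p) (b | q)
    · rcases P.comparable a b with e | e | e | e | e
      · exact Or.inl (by rw [e])
      · exact Or.inr (Or.inl (Or.inl ⟨a, b, e, rfl, rfl⟩))
      · exact Or.inr (Or.inr (Or.inl (Or.inl ⟨b, a, e, rfl, rfl⟩)))
      · exact Or.inr (Or.inr (Or.inr (Or.inl (.single (Or.inl ⟨a, b, e, rfl, rfl⟩)))))
      · exact Or.inr (Or.inr (Or.inr (Or.inr (.single (Or.inl ⟨b, a, e, rfl, rfl⟩)))))
    · by_cases ha : a ∈ P.T
      · have := hQ (f.equiv ⟨a, ha⟩) q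
        rwa [hq, f.inR_equiv] at this
      · exact Or.inr (Or.inl (Or.inr (Or.inr ⟨a, q, ha, q.2, rfl, hq q⟩)))
    · by_cases hb : b ∈ P.T
      · have := hQ p (f.equiv ⟨b, hb⟩)
        rwa [hq, f.inR_equiv] at this
      · exact Or.inr (Or.inr (Or.inl (Or.inr (Or.inr ⟨b, p, hb, p.2, rfl, hq p⟩))))
    · have := hQ p q
      rwa [hq, hq] at this
  S_minimal := by
    rintro _ ⟨s, hs, rfl⟩ y (⟨a, b, h, rfl, e⟩ | ⟨a, b, h, rfl, e⟩ | ⟨a, b, ha, hb, rfl, e⟩)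
    · cases e
      exact P.S_minimal _ hs _ h
    · exact Q.S_minimal _ (f.inR_eq_inl e).2 _ h
    · exact hb (f.inR_eq_inl e).2
  T_maximal := by
    rintro _ ⟨t, ht, rfl⟩ y (⟨a, b, h, e, rfl⟩ | ⟨a, b, h, e, rfl⟩ | ⟨a, b, ha, hb, e, rfl⟩)
    · exact P.T_maximal _ (f.inR_eq_inl e.symm).1 _ h
    · cases f.inR_injective e
      exact Q.T_maximal _ ht _ h
    · exact ha (f.inR_eq_inl e.symm).1

end Glue

/-- The discrete iposet on the lo-set `U` with source interface `S` and target interface `T`. -/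
def discrete (U : LoSet α) (S T : Set (Fin U.size)) : Iposet α where
  carrier := Fin U.size
  finite := inferInstance
  prec _ _ := False
  event i j := i < j
  S := S
  T := T
  label := U.label
  prec_irrefl _ h := h
  prec_trans _ _ _ h _ := h
  event_irrefl := lt_irrefl
  event_trans _ _ _ := lt_trans
  comparable x y := by
    rcases lt_trichotomy x y with h | h | h <;> simp [h]
  S_minimal _ _ _ h := h
  T_maximal _ _ _ h := h

/-- An isomorphism of lo-sets from `U` to a set `I` of events (an interface) of `P`. -/
structure Marking (U : LoSet α) (P : Iposet α) (I : Set P.carrier) where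
  equiv : Fin U.size ≃ I
  event_iff : ∀ i j, i < j ↔ P.event (equiv i) (equiv j)
  label_eq : ∀ i, P.label (equiv i) = U.label i

/-- The whole of a lo-set, marked by itself. -/
def Marking.univ (U : LoSet α) (S T : Set (Fin U.size)) :
    Marking U (discrete U S T) (Set.univ : Set (Fin U.size)) where
  equiv := (Equiv.Set.univ _).symm
  event_iff _ _ := Iff.rfl
  label_eq _ := rfl

/-- The image of a coface map, marked by the source of that map. -/
noncomputable def Marking.range {U V : LoSet α} (d : Coface U V) (S T : Set (Fin V.size)) :
    Marking U (discrete V S T) (Set.range d.map) where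
  equiv := Equiv.ofInjective d.map d.map.injective
  event_iff _ _ := d.map.lt_iff_lt.symm
  label_eq i := d.label_map i

/-- Interfaces isomorphic to the same lo-set match. -/
def Marking.matching {U : LoSet α} {P Q : Iposet α} (s : Marking U P P.T) (t : Marking U Q Q.S) :
    Matching P Q where
  equiv := s.equiv.symm.trans t.equiv
  event_iff x y := by
    obtain ⟨i, rfl⟩ := s.equiv.surjective x
    obtain ⟨j, rfl⟩ := s.equiv.surjective y
    simp [← s.event_iff, ← t.event_iff]
  label_eq x := by
    obtain ⟨i, rfl⟩ := s.equiv.surjective x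
    simp [s.label_eq, t.label_eq]

/-- The source interface of a gluing is that of its first factor. -/
noncomputable def Marking.glue {U : LoSet α} {P Q : Iposet α} (s : Marking U P P.S)
    (f : Matching P Q) : Marking U (P.glue Q f) (P.glue Q f).S where
  equiv := s.equiv.trans (Equiv.Set.image Sum.inl P.S Sum.inl_injective)
  event_iff i j := by
    rw [s.event_iff]
    refine ⟨fun h => .single (Or.inl ⟨_, _, h, rfl, rfl⟩), fun h => ?_⟩
    rcases lt_trichotomy i j with hij | rfl | hij
    · exact (s.event_iff _ _).1 hij
    · exact ((P.glue Q f).event_irrefl _ h).elim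
    · have h' : (P.glue Q f).event (Sum.inl (s.equiv j)) (Sum.inl (s.equiv i)) :=
        .single (Or.inl ⟨_, _, (s.event_iff _ _).1 hij, rfl, rfl⟩)
      exact ((P.glue Q f).event_irrefl _ ((P.glue Q f).event_trans _ _ _ h h')).elim
  label_eq i := s.label_eq i

end Iposet

/-- Ipomsets: isomorphism classes of labelled iposets. -/
def Ipomset (α : Type u) := Quotient (Iposet.isoSetoid α)

namespace Ipomset

variable {α : Type u}

/-- The ipomset of a labelled iposet. -/
def mk (P : Iposet α) : Ipomset α := Quotient.mk _ P

/-- `P` is an interval ipomset. -/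
def IsInterval (P : Ipomset α) : Prop :=
  Quotient.lift Iposet.IsInterval
    (fun P Q (h : P.Isomorphic Q) => propext ⟨h.symm.isInterval, h.isInterval⟩) P

/-- `P ⊑ Q`. -/
def Subsumed (P Q : Ipomset α) : Prop :=
  Quotient.lift₂ Iposet.Subsumed
    (fun P Q P' Q' (h : P.Isomorphic P') (h' : Q.Isomorphic Q') => propext
      ⟨fun k => (h.symm.subsumed.trans k).trans h'.subsumed,
        fun k => (h.subsumed.trans k).trans h'.symm.subsumed⟩) P Q

/-- `R = P * Q`; in particular `P * Q` is defined, i.e. `T_P ≃ S_Q`. -/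
def IsGluing (P Q R : Ipomset α) : Prop :=
  ∃ (p q : Iposet α) (f : Iposet.Matching p q), mk p = P ∧ mk q = Q ∧ mk (p.glue q f) = R

/-! ### Languages -/

/-- The down-closure of a set of ipomsets, within the interval ipomsets. -/
def downClosure (A : Set (Ipomset α)) : Set (Ipomset α) :=
  {P | P.IsInterval ∧ ∃ Q ∈ A, P.Subsumed Q}

/-- A language: a set of interval ipomsets that is down-closed (among interval ipomsets). -/
def IsLanguage (L : Set (Ipomset α)) : Prop :=
  (∀ P ∈ L, P.IsInterval) ∧ ∀ P Q : Ipomset α, P.IsInterval → P.Subsumed Q → Q ∈ L → P ∈ L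

/-- The gluing composition `L * M` of languages. -/
def langGlue (L M : Set (Ipomset α)) : Set (Ipomset α) :=
  downClosure {R | ∃ P ∈ L, ∃ Q ∈ M, IsGluing P Q R}

/-- `langPow L n` is `L ^ (n + 1)`. -/
def langPow (L : Set (Ipomset α)) : ℕ → Set (Ipomset α)
  | 0 => L
  | n + 1 => langGlue L (langPow L n)

/-- The Kleene plus, the union of all `L ^ n` with `n ≥ 1`. -/
def kleenePlus (L : Set (Ipomset α)) : Set (Ipomset α) := ⋃ n, langPow L n

end Ipomset

/-! ### Paths and their ipomsets -/

section Paths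

variable {α : Type u}

/-- Steps in a precubical set: up-steps along `d_{A,∅}` from a lower face to a cell, and down-steps
along `d_{∅,B}` from a cell to an upper face. -/
inductive Step (X : PrecubicalSet α) : Cell X → Cell X → Type u
  | up {U V : LoSet α} (x : X.obj (op U)) (y : X.obj (op V)) (d : U ⟶ V)
      (hd : Coface.B d = ∅) (h : X.map d.op y = x) : Step X ⟨U, x⟩ ⟨V, y⟩
  | down {U V : LoSet α} (x : X.obj (op U)) (y : X.obj (op V)) (d : V ⟶ U)
      (hd : Coface.A d = ∅) (h : X.map d.op x = y) : Step X ⟨U, x⟩ ⟨V, y⟩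

/-- Paths in a precubical set: finite sequences of consecutive steps. -/
inductive HPath (X : PrecubicalSet α) : Cell X → Cell X → Type u
  | nil (x : Cell X) : HPath X x x
  | cons {x y z : Cell X} (s : Step X x y) (p : HPath X y z) : HPath X x z

/-- The iposet of a step. For an up-step inserting `A` into `V \ A` it is the discrete iposet `V`
with source interface `V \ A` and target interface `V`; for a down-step removing `B` from `U` it is
`U` with source interface `U` and target interface `U \ B`. -/
noncomputable def Step.ev {X : PrecubicalSet α} {x y : Cell X} : Step X x y → Iposet α
  | @Step.up _ _ _ V _ _ d _ _ => Iposet.discrete V (Set.range (Coface.map d)) Set.univ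
  | @Step.down _ _ U _ _ _ d _ _ => Iposet.discrete U Set.univ (Set.range (Coface.map d))

/-- The source interface of the iposet of a step consists of the events of its source cell. -/
noncomputable def Step.src {X : PrecubicalSet α} {x y : Cell X} :
    (s : Step X x y) → Iposet.Marking x.1 s.ev s.ev.S
  | .up _ _ d _ _ => Iposet.Marking.range d _ _
  | .down _ _ _ _ _ => Iposet.Marking.univ _ _ _

/-- The target interface of the iposet of a step consists of the events of its target cell. -/
noncomputable def Step.tgt {X : PrecubicalSet α} {x y : Cell X} :
    (s : Step X x y) → Iposet.Marking y.1 s.ev s.ev.T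
  | .up _ _ _ _ _ => Iposet.Marking.univ _ _ _
  | .down _ _ d _ _ => Iposet.Marking.range d _ _

/-- The iposet `ev(α)` of a path, with the isomorphism from the events of the source cell of the
path to the source interface. A path of length `0` yields the identity on the events of its cell,
other paths yield the gluing of their steps (the last factor, an identity, is neutral). -/
noncomputable def HPath.evAux {X : PrecubicalSet α} {x y : Cell X} :
    HPath X x y → Σ P : Iposet α, Iposet.Marking x.1 P P.S
  | .nil x => ⟨Iposet.discrete x.1 Set.univ Set.univ, Iposet.Marking.univ _ _ _⟩
  | .cons s p =>
    ⟨s.ev.glue p.evAux.1 (s.tgt.matching p.evAux.2), s.src.glue (s.tgt.matching p.evAux.2)⟩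

/-- The ipomset `ev(α)` of a path. -/
noncomputable def HPath.ev {X : PrecubicalSet α} {x y : Cell X} (p : HPath X x y) : Ipomset α :=
  Ipomset.mk p.evAux.1

/-- The set of ipomsets of accepting paths of an HDA. -/
def HDA.lang (X : HDA α) : Set (Ipomset α) :=
  {P | ∃ x ∈ X.start, ∃ y ∈ X.accept, ∃ p : HPath X.cells x y, p.ev = P}

/-- `L` is regular: it is recognised by an HDA. -/
def IsRegular (L : Set (Ipomset α)) : Prop := ∃ X : HDA α, X.lang = L

end Paths

end HDALang

namespace HDALang

variable {α : Type u}

/-! ### Coface maps -/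

namespace Coface

variable {U V W V₀ : LoSet α}

/-! Ipomsets are replaced by step words, the sequences of starts and terminations read along paths.
Every interval ipomset is the ipomset of a step word (`Ipomset.IsInterval.exists_stepWord`), and
concatenation of words is gluing up to isomorphism. Subsumption becomes combinatorial: the ipomset
of `w` is subsumed by that of `v` exactly when `w` arises from `v` by delaying starts and advancing
terminations, which is the relation `StepWord.Align` (`StepWord.subsumed_iff_align`). Faces of cells
imitate such changes, so the language of any HDA is down-closed (`Acc.of_align`). Hence the Kleene
plus consists of the interval ipomsets subsumed by words of paths in `X` that may jump from accept
cells to start cells (`HDA.mem_kleenePlus_iff`); this already makes it a language.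

It remains to simulate the jumps in an HDA, which has no silent transitions. Identifying accept
cells with start cells would also identify their faces and may create unwanted paths. Instead, while
reading `w`, one guesses a word `v` aligned with it. The state is a virtual cell `(x, d)`: `x` is
the current cell of `X` on the path over `v`, and `d` embeds the events active in `w` into those of
`x`. Steps of `w` change only `d`; steps of `v` and jumps are silent (`VAcc.alignAcc`,
`VAcc.of_align`).

Lax cells absorb the silent moves. A lax cell over `U` assigns to each face of `U` a virtual cell
that silently leads to the corresponding face of the one above it, with equality along terminating
faces. A sequence of silent moves followed by a start is then a single up-step
(`LaxCell.exists_extension`). Silent moves before a termination can be postponed, because they are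
compatible with faces, and those at the end are absorbed by the choice of accept cells. The
automaton is finite because a finite lo-set has finitely many faces. -/

theorem mem_range_iff (d : Coface U V) (k : Fin V.size) :
    k ∈ Set.range d.map ↔ k ∉ d.A ∧ k ∉ d.B := by
  have := Set.ext_iff.1 d.compl_range k
  simp only [Set.mem_compl_iff, Set.mem_union] at this
  tauto

theorem notMem_A (d : Coface U V) (i : Fin U.size) : d.map i ∉ d.A :=
  ((d.mem_range_iff _).1 ⟨i, rfl⟩).1

theorem notMem_B (d : Coface U V) (i : Fin U.size) : d.map i ∉ d.B :=
  ((d.mem_range_iff _).1 ⟨i, rfl⟩).2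

@[simp] theorem id_A : Coface.A (𝟙 U : U ⟶ U) = ∅ := rfl
@[simp] theorem id_B : Coface.B (𝟙 U : U ⟶ U) = ∅ := rfl
@[simp] theorem comp_map (d : U ⟶ V) (e : V ⟶ W) (i : Fin U.size) :
    Coface.map (d ≫ e) i = Coface.map e (Coface.map d i) := rfl
theorem comp_A (d : U ⟶ V) (e : V ⟶ W) :
    Coface.A (d ≫ e) = Coface.map e '' Coface.A d ∪ Coface.A e := rfl
theorem comp_B (d : U ⟶ V) (e : V ⟶ W) :
    Coface.B (d ≫ e) = Coface.map e '' Coface.B d ∪ Coface.B e := rfl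

theorem A_eq (d : Coface U V) : d.A = (Set.range d.map)ᶜ \ d.B := by
  ext k
  have := d.mem_range_iff k
  have h2 : k ∈ d.A → k ∉ d.B := fun h => Set.disjoint_left.1 d.disjoint h
  simp only [Set.mem_sdiff, Set.mem_compl_iff]
  tauto

theorem ext_map_B {d e : Coface U V} (h : ∀ i, d.map i = e.map i) (hB : d.B = e.B) : d = e := by
  have hm : d.map = e.map := by ext i; rw [h]
  exact Coface.ext hm (by rw [A_eq, A_eq, hm, hB]) hB

/-- The coface map with given underlying map and given set of terminated events. -/
def ofMap (g : Fin U.size → Fin V.size) (hg : ∀ i j, i < j → g i < g j)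
    (hl : ∀ i, V.label (g i) = U.label i) (B : Set (Fin V.size)) (hB : ∀ i, g i ∉ B) :
    Coface U V where
  map := OrderEmbedding.ofStrictMono g fun i j => hg i j
  A := (Set.range g)ᶜ \ B
  B := B
  label_map := hl
  disjoint := Set.disjoint_sdiff_left
  compl_range := by
    have : B ⊆ (Set.range g)ᶜ := by
      rintro _ hk ⟨i, rfl⟩
      exact hB i hk
    rw [Set.sdiff_union_of_subset this]
    rfl

/-- A coface map whose complement is contained in that of `c` is a factor of `c`. -/
theorem exists_factor (c : W ⟶ V) (a : V₀ ⟶ V) (hA : Coface.A a ⊆ Coface.A c)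
    (hB : Coface.B a ⊆ Coface.B c) : ∃ c' : W ⟶ V₀, c' ≫ a = c := by
  have hr : ∀ i, ∃ j, Coface.map a j = Coface.map c i := fun i =>
    (a.mem_range_iff _).2 ⟨fun h => c.notMem_A i (hA h), fun h => c.notMem_B i (hB h)⟩
  choose g hg using hr
  have hdisj := Set.disjoint_left.1 c.disjoint
  let c' : Coface W V₀ :=
    { map := OrderEmbedding.ofMapLEIff g fun i j => by
        rw [← (Coface.map a).le_iff_le, hg, hg, (Coface.map c).le_iff_le]
      A := Coface.map a ⁻¹' Coface.A c
      B := Coface.map a ⁻¹' Coface.B c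
      label_map := fun i => by
        rw [← c.label_map, ← hg, a.label_map]
        rfl
      disjoint := by
        rw [Set.disjoint_left]
        exact fun k h1 h2 => hdisj h1 h2
      compl_range := by
        ext k
        have h := c.mem_range_iff (Coface.map a k)
        have h' : k ∈ Set.range g ↔ Coface.map a k ∈ Set.range (Coface.map c) := by
          constructor
          · rintro ⟨i, rfl⟩
            exact ⟨i, (hg i).symm⟩
          · rintro ⟨i, hi⟩
            exact ⟨i, (Coface.map a).injective ((hg i).trans hi)⟩
        simp only [OrderEmbedding.coe_ofMapLEIff, Set.mem_compl_iff, Set.mem_union,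
          Set.mem_preimage, h', h]
        tauto }
  refine ⟨c', ext_map_B hg ?_⟩
  change Coface.map a '' (Coface.map a ⁻¹' Coface.B c) ∪ Coface.B a = Coface.B c
  ext k
  constructor
  · rintro (⟨j, hj, rfl⟩ | h)
    · exact hj
    · exact hB h
  · intro hk
    by_cases hka : k ∈ Coface.B a
    · exact Or.inr hka
    · obtain ⟨j, rfl⟩ := (a.mem_range_iff k).2 ⟨fun h => hdisj (hA h) hk, hka⟩
      exact Or.inl ⟨j, hk, rfl⟩

/-- Coface maps are monomorphisms, so the factor produced by `exists_factor` is unique; this makes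
the extension of lax cells well defined. -/
theorem comp_right_cancel {c c' : W ⟶ V₀} {a : V₀ ⟶ V} (h : c ≫ a = c' ≫ a) : c = c' := by
  refine ext_map_B (fun i => (Coface.map a).injective ?_) ?_
  · rw [← comp_map, ← comp_map, h]
  · have hB := congrArg Coface.B h
    rw [comp_B, comp_B] at hB
    ext k
    have := Set.ext_iff.1 hB (Coface.map a k)
    simpa [a.notMem_B k] using this

/-- A coface map without missing events is an identity. -/
theorem eq_id_of_empty {c : U ⟶ V} (hA : Coface.A c = ∅) (hB : Coface.B c = ∅) :
    ∃ h : U = V, c = eqToHom h := by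
  have hs : Function.Surjective (Coface.map c) := fun k =>
    (c.mem_range_iff k).2 ⟨by simp [hA], by simp [hB]⟩
  have hcard : U.size = V.size := by
    simpa using Fintype.card_congr (Equiv.ofBijective _ ⟨(Coface.map c).injective, hs⟩)
  obtain ⟨n, l⟩ := U
  obtain ⟨m, l'⟩ := V
  obtain rfl : n = m := hcard
  have hid : ∀ i, Coface.map c i = i := by
    have : (RelIso.ofSurjective (Coface.map c) hs : Fin n ≃o Fin n) = OrderIso.refl _ :=
      Subsingleton.elim _ _
    exact fun i => DFunLike.congr_fun this i
  obtain rfl : l = l' := by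
    funext i
    have := c.label_map i
    rw [hid] at this
    exact this.symm
  exact ⟨rfl, ext_map_B hid hB⟩

end Coface

/-- There are finitely many coface maps with a given target. -/
instance LoSet.finite_cofaces (V : LoSet α) : Finite (Σ U : LoSet α, U ⟶ V) := by
  let D := Σ n : Fin (V.size + 1), {x : (Fin n ↪o Fin V.size) × Set (Fin V.size) ×
    Set (Fin V.size) // Disjoint x.2.1 x.2.2 ∧ (Set.range x.1)ᶜ = x.2.1 ∪ x.2.2}
  let F : D → Σ U : LoSet α, U ⟶ V := fun x =>
    ⟨⟨x.1, fun i => V.label (x.2.1.1 i)⟩, ⟨x.2.1.1, x.2.1.2.1, x.2.1.2.2, fun _ => rfl,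
      x.2.2.1, x.2.2.2⟩⟩
  have : ∀ n : ℕ, Finite (Fin n ↪o Fin V.size) := fun n =>
    Finite.of_injective (fun f : Fin n ↪o Fin V.size => (f : Fin n → Fin V.size))
      DFunLike.coe_injective
  refine Finite.of_surjective F ?_
  -- The labels `l` are a separate variable so that they can be replaced by those pulled back along
  -- `m`: a coface map determines the labels of its source.
  have key : ∀ (n : ℕ) (l : Fin n → α) (m : Fin n ↪o Fin V.size) (A B : Set (Fin V.size))
      (hl : ∀ i, V.label (m i) = l i) (h1 : Disjoint A B) (h2 : (Set.range m)ᶜ = A ∪ B),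
      ∃ x, F x = ⟨⟨n, l⟩, ⟨m, A, B, hl, h1, h2⟩⟩ := by
    intro n l m A B hl h1 h2
    obtain rfl : (fun i => V.label (m i)) = l := funext hl
    have hn : n ≤ V.size := by simpa using Fintype.card_le_of_injective _ m.injective
    exact ⟨⟨⟨n, Nat.lt_succ_of_le hn⟩, ⟨⟨m, A, B⟩, h1, h2⟩⟩, rfl⟩
  rintro ⟨⟨n, l⟩, ⟨m, A, B, hl, h1, h2⟩⟩
  exact key n l m A B hl h1 h2

/-! ### Step words -/

/-- Composable sequences of starting and terminating coface maps. -/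
inductive StepWord (α : Type u) : LoSet α → LoSet α → Type u
  | nil (U : LoSet α) : StepWord α U U
  | up {U V W : LoSet α} (a : U ⟶ V) (ha : Coface.B a = ∅) (w : StepWord α V W) :
      StepWord α U W
  | down {U V W : LoSet α} (b : V ⟶ U) (hb : Coface.A b = ∅) (w : StepWord α V W) :
      StepWord α U W

namespace StepWord

/-- Concatenation of step words. -/
def append : {U V W : LoSet α} → StepWord α U V → StepWord α V W → StepWord α U W
  | _, _, _, nil _, v => v
  | _, _, _, up a ha w, v => up a ha (w.append v)
  | _, _, _, down b hb w, v => down b hb (w.append v)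

/-- `Align w v d`: the events of `w` can be obtained by delaying the start and advancing the
termination of events of `v`. The coface map `d` relates the events that are currently active: its
`A` consists of the events whose start is delayed, its `B` of those terminated in advance. -/
inductive Align : {U W V W' : LoSet α} → StepWord α U W → StepWord α V W' → (U ⟶ V) → Prop
  | nil (U : LoSet α) : Align (nil U) (nil U) (𝟙 U)
  | startRight {U W V V₁ W' : LoSet α} {w : StepWord α U W} {d : U ⟶ V} (a : V ⟶ V₁)
      (ha : Coface.B a = ∅) {v : StepWord α V₁ W'} (h : Align w v (d ≫ a)) : Align w (up a ha v) d
  | endRight {U W V V₁ W' : LoSet α} {w : StepWord α U W} {d : U ⟶ V₁} (b : V₁ ⟶ V)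
      (hb : Coface.A b = ∅) {v : StepWord α V₁ W'} (h : Align w v d) :
      Align w (down b hb v) (d ≫ b)
  | startLeft {U U₁ W V W' : LoSet α} (a : U ⟶ U₁) (ha : Coface.B a = ∅) {w : StepWord α U₁ W}
      {v : StepWord α V W'} {d : U₁ ⟶ V} (h : Align w v d) : Align (up a ha w) v (a ≫ d)
  | endLeft {U U₁ W V W' : LoSet α} (b : U₁ ⟶ U) (hb : Coface.A b = ∅) {w : StepWord α U₁ W}
      {v : StepWord α V W'} {d : U ⟶ V} (h : Align w v (b ≫ d)) : Align (down b hb w) v d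

end StepWord

/-! ### Acceptance of step words by precubical sets -/

/-- `Acc X acc w x`: there is a path over the word `w` from `x` to a cell in `acc`. -/
def Acc (X : PrecubicalSet α) (acc : Set (Cell X)) :
    {U W : LoSet α} → StepWord α U W → X.obj (op U) → Prop
  | U, _, .nil _, x => (⟨U, x⟩ : Cell X) ∈ acc
  | _, _, .up (V := V) a _ w, x => ∃ y : X.obj (op V), X.map a.op y = x ∧ Acc X acc w y
  | _, _, .down b _ w, x => Acc X acc w (X.map b.op x)

/-- A path over `v` yields one over `w` by passing to the `d`-faces of its cells: the alignment says
which events to omit at each moment, as not yet started or as already terminated. Taking `d` to be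
an identity gives closure of HDA languages under subsumption. -/
theorem Acc.of_align {X : PrecubicalSet α} {acc : Set (Cell X)} {U W V W' : LoSet α}
    {w : StepWord α U W} {v : StepWord α V W'} {d : U ⟶ V} (h : StepWord.Align w v d) :
    ∀ x, Acc X acc v x → Acc X acc w (X.map d.op x) := by
  induction h with
  | nil U => intro x hx; simpa using hx
  | startRight a ha h ih =>
    rintro _ ⟨y, rfl, hy⟩
    simpa using ih y hy
  | endRight b hb h ih =>
    intro x hx
    simpa using ih _ hx
  | startLeft a ha h ih =>
    intro x hx
    exact ⟨_, by simp, ih x hx⟩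
  | endLeft b hb h ih =>
    intro x hx
    simpa [Acc] using ih x hx

/-- The word of a path. -/
def HPath.word {X : PrecubicalSet α} {x y : Cell X} : HPath X x y → StepWord α x.1 y.1
  | .nil x => .nil x.1
  | .cons (.up _ _ d hd _) p => .up d hd p.word
  | .cons (.down _ _ d hd _) p => .down d hd p.word

theorem Acc.of_path {X : PrecubicalSet α} {acc : Set (Cell X)} {x y : Cell X} (p : HPath X x y)
    (hy : y ∈ acc) : Acc X acc p.word x.2 := by
  induction p with
  | nil x => exact hy
  | cons s p ih =>
    cases s with
    | up x y d hd h => exact ⟨y, h, ih hy⟩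
    | down x y d hd h => subst h; exact ih hy

theorem Acc.exists_path {X : PrecubicalSet α} {acc : Set (Cell X)} {U W : LoSet α}
    (w : StepWord α U W) :
    ∀ x, Acc X acc w x → ∃ y : X.obj (op W), (⟨W, y⟩ : Cell X) ∈ acc ∧
      ∃ p : HPath X ⟨U, x⟩ ⟨W, y⟩, p.word = w := by
  induction w with
  | nil U => exact fun x hx => ⟨x, hx, .nil _, rfl⟩
  | up a ha w ih =>
    rintro x ⟨y, h, hy⟩
    obtain ⟨z, hz, p, rfl⟩ := ih y hy
    exact ⟨z, hz, .cons (.up x y a ha h) p, rfl⟩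
  | down b hb w ih =>
    intro x hx
    obtain ⟨z, hz, p, rfl⟩ := ih _ hx
    exact ⟨z, hz, .cons (.down x _ b hb rfl) p, rfl⟩

/-! ### Virtual cells -/

/-- A virtual cell over `U` is a cell of `X` over some `V` together with a coface map `U ⟶ V`:
the events in `A` of that map are virtually active, but their start has been delayed, while those
in `B` have been terminated ahead of time. -/
abbrev VirtualCell (X : PrecubicalSet α) (U : LoSet α) : Type u :=
  Σ V : LoSet α, X.obj (op V) × (U ⟶ V)

namespace VirtualCell

variable {X : PrecubicalSet α} {U V W : LoSet α}

/-- The faces of a virtual cell. -/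
def face (e : V ⟶ U) (c : VirtualCell X U) : VirtualCell X V := ⟨c.1, c.2.1, e ≫ c.2.2⟩

@[simp] theorem face_mk (e : V ⟶ U) (x : X.obj (op W)) (d : U ⟶ W) :
    face e (⟨W, x, d⟩ : VirtualCell X U) = ⟨W, x, e ≫ d⟩ := rfl

@[simp] theorem face_id (c : VirtualCell X U) : c.face (𝟙 U) = c := by
  simp [face]

@[simp] theorem face_face (e : W ⟶ V) (e' : V ⟶ U) (c : VirtualCell X U) :
    (c.face e').face e = c.face (e ≫ e') := by
  simp [face]

end VirtualCell

/-- The silent moves between virtual cells: passing from an accept cell to a start cell, and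
starting or terminating events in the underlying cell only. -/
inductive SilentStep (X : HDA α) : {U : LoSet α} → VirtualCell X.cells U →
    VirtualCell X.cells U → Prop
  | jump {U V : LoSet α} {x y : X.cells.obj (op V)} (d : U ⟶ V) (hx : ⟨V, x⟩ ∈ X.accept)
      (hy : ⟨V, y⟩ ∈ X.start) : SilentStep X ⟨V, x, d⟩ ⟨V, y, d⟩
  | start {U V V₁ : LoSet α} (a : V ⟶ V₁) (ha : Coface.B a = ∅) (y : X.cells.obj (op V₁))
      (d : U ⟶ V) : SilentStep X ⟨V, X.cells.map a.op y, d⟩ ⟨V₁, y, d ≫ a⟩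
  | finish {U V V₁ : LoSet α} (b : V₁ ⟶ V) (hb : Coface.A b = ∅) (x : X.cells.obj (op V))
      (d : U ⟶ V₁) : SilentStep X ⟨V, x, d ≫ b⟩ ⟨V₁, X.cells.map b.op x, d⟩

/-- Sequences of silent moves. -/
abbrev Silent (X : HDA α) {U : LoSet α} (c c' : VirtualCell X.cells U) : Prop :=
  Relation.ReflTransGen (SilentStep X) c c'

/-- Silent moves act on the underlying cell of `X`, whereas faces act by precomposition on the
coface map, so the two are compatible. -/
theorem SilentStep.face {X : HDA α} {U V : LoSet α} (e : V ⟶ U) {c c' : VirtualCell X.cells U}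
    (h : SilentStep X c c') : SilentStep X (c.face e) (c'.face e) := by
  cases h with
  | jump d hx hy => exact .jump _ hx hy
  | start a ha y d =>
    rw [VirtualCell.face_mk, VirtualCell.face_mk, ← Category.assoc]
    exact .start a ha y _
  | finish b hb x d =>
    rw [VirtualCell.face_mk, VirtualCell.face_mk, ← Category.assoc]
    exact .finish b hb x _

theorem Silent.face {X : HDA α} {U V : LoSet α} (e : V ⟶ U) {c c' : VirtualCell X.cells U}
    (h : Silent X c c') : Silent X (c.face e) (c'.face e) :=
  Relation.ReflTransGen.lift (VirtualCell.face e) (fun _ _ => SilentStep.face e) _ _ h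

/-- A virtual cell is accepting if it is an accept cell with all events active. -/
def IsAccepting (X : HDA α) {U : LoSet α} (c : VirtualCell X.cells U) : Prop :=
  ∃ x : X.cells.obj (op U), (⟨U, x⟩ : Cell X.cells) ∈ X.accept ∧ c = ⟨U, x, 𝟙 U⟩

/-- Acceptance of step words by virtual cells with silent moves. -/
def VAcc (X : HDA α) : {U W : LoSet α} → StepWord α U W → VirtualCell X.cells U → Prop
  | _, _, .nil _, c => ∃ c', Silent X c c' ∧ IsAccepting X c'
  | _, _, .up (V := V) a _ w, c =>
    ∃ c' : VirtualCell X.cells V, Silent X c (c'.face a) ∧ VAcc X w c'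
  -- Silent moves before a termination need not be allowed here: by `Silent.face` they can be
  -- performed afterwards.
  | _, _, .down b _ w, c => VAcc X w (c.face b)

theorem VAcc.of_silent {X : HDA α} {U W : LoSet α} (w : StepWord α U W) :
    ∀ {c c' : VirtualCell X.cells U}, Silent X c c' → VAcc X w c' → VAcc X w c := by
  induction w with
  | nil U => exact fun h ⟨c'', h', hc⟩ => ⟨c'', h.trans h', hc⟩
  | up a ha w ih => exact fun h ⟨c'', h', hc⟩ => ⟨c'', h.trans h', hc⟩
  | down b hb w ih => exact fun h h' => ih (h.face b) h'

/-! ### Lax cells -/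

/-- A lax cell over `U`: a virtual cell for every face of `U`, compatibly with upper faces, and
up to silent moves also with lower faces. -/
structure LaxCell (X : HDA α) (U : LoSet α) where
  toFun : ∀ W : LoSet α, (W ⟶ U) → VirtualCell X.cells W
  strict : ∀ {W W' : LoSet α} (e : W' ⟶ W) (c : W ⟶ U), Coface.A e = ∅ →
    toFun _ (e ≫ c) = (toFun _ c).face e
  lax : ∀ {W W' : LoSet α} (e : W' ⟶ W) (c : W ⟶ U),
    Silent X (toFun _ (e ≫ c)) ((toFun _ c).face e)

namespace LaxCell

variable {X : HDA α} {U V W : LoSet α}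

theorem ext {F G : LaxCell X U} (h : ∀ W c, F.toFun W c = G.toFun W c) : F = G := by
  cases F
  cases G
  congr
  funext W c
  exact h W c

/-- The top virtual cell of a lax cell. -/
def top (F : LaxCell X U) : VirtualCell X.cells U := F.toFun U (𝟙 U)

/-- The faces of a lax cell. -/
def face (e : V ⟶ U) (F : LaxCell X U) : LaxCell X V where
  toFun W c := F.toFun W (c ≫ e)
  strict e' c h := by rw [Category.assoc, F.strict _ _ h]
  lax e' c := by rw [Category.assoc]; exact F.lax _ _

@[simp] theorem face_id (F : LaxCell X U) : F.face (𝟙 U) = F :=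
  ext fun _ _ => by simp [face]

theorem face_comp (e : W ⟶ V) (e' : V ⟶ U) (F : LaxCell X U) :
    F.face (e ≫ e') = (F.face e').face e :=
  ext fun _ _ => by simp [face]

theorem toFun_silent (F : LaxCell X U) (e : V ⟶ U) :
    Silent X (F.toFun V e) (F.top.face e) := by
  have := F.lax e (𝟙 U)
  rwa [Category.comp_id] at this

theorem top_face_silent (F : LaxCell X U) (e : V ⟶ U) :
    Silent X (F.face e).top (F.top.face e) := by
  simpa [top, face] using F.toFun_silent e

theorem top_face_of_A_empty (F : LaxCell X U) (e : V ⟶ U) (he : Coface.A e = ∅) :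
    (F.face e).top = F.top.face e := by
  simpa [top, face] using F.strict e (𝟙 U) he

/-- The lax cell of all faces of a virtual cell. -/
def ofVirtual (c : VirtualCell X.cells U) : LaxCell X U where
  toFun _ e := c.face e
  strict _ _ _ := by simp
  lax _ _ := by simp; rfl

@[simp] theorem ofVirtual_top (c : VirtualCell X.cells U) : (ofVirtual c).top = c := by
  simp [ofVirtual, top]

open Classical in
/-- A lax cell on a lower face extends along any virtual cell that the top of the given lax cell
silently lies below. -/
theorem exists_extension (F : LaxCell X U) (a : U ⟶ V) (ha : Coface.B a = ∅)
    (c : VirtualCell X.cells V) (h : Silent X F.top (c.face a)) :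
    ∃ G : LaxCell X V, G.face a = F ∧ Silent X G.top c := by
  -- On faces that omit the newly started events the given lax cell is kept; on all others the faces
  -- of `c` are taken.
  let G : ∀ W : LoSet α, (W ⟶ V) → VirtualCell X.cells W := fun W e =>
    if h : ∃ e', e' ≫ a = e then F.toFun W h.choose else c.face e
  have hG₁ : ∀ {W : LoSet α} (e : W ⟶ U), G W (e ≫ a) = F.toFun W e := by
    intro W e
    have h : ∃ e', e' ≫ a = e ≫ a := ⟨e, rfl⟩
    simp only [G, dif_pos h]
    rw [Coface.comp_right_cancel h.choose_spec]
  have hG₂ : ∀ {W : LoSet α} (e : W ⟶ V), (¬ ∃ e', e' ≫ a = e) → G W e = c.face e :=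
    fun e h => dif_neg h
  have hG₃ : ∀ {W : LoSet α} (e : W ⟶ V), Silent X (G W e) (c.face e) := by
    intro W e
    by_cases he : ∃ e', e' ≫ a = e
    · obtain ⟨e', rfl⟩ := he
      rw [hG₁, ← VirtualCell.face_face]
      exact (F.toFun_silent e').trans (h.face e')
    · rw [hG₂ e he]
  refine ⟨⟨G, ?_, ?_⟩, ?_, ?_⟩
  · intro W W' e e' he
    by_cases h' : ∃ k, k ≫ a = e'
    · obtain ⟨k, rfl⟩ := h'
      rw [← Category.assoc, hG₁, hG₁, F.strict _ _ he]
    · rw [hG₂ _ h', hG₂, VirtualCell.face_face]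
      -- Since `B` of `a` is empty, factoring through `a` means that `A` contains `A` of `a`.
      -- Precomposing with a purely terminating `e` does not enlarge `A`, so it leads from a face
      -- outside the image of `F` to another such face.
      rintro ⟨k, hk⟩
      refine h' (Coface.exists_factor e' a ?_ (by simp [ha]))
      have := congrArg Coface.A hk
      rw [Coface.comp_A, Coface.comp_A, he, Set.image_empty, Set.empty_union] at this
      rw [← this]
      exact Set.subset_union_right
  · intro W W' e e'
    by_cases h' : ∃ k, k ≫ a = e'
    · obtain ⟨k, rfl⟩ := h'
      rw [← Category.assoc, hG₁, hG₁]
      exact F.lax _ _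
    · rw [hG₂ _ h', VirtualCell.face_face]
      exact hG₃ _
  · exact ext fun W e => hG₁ e
  · have := hG₃ (𝟙 V)
    rwa [VirtualCell.face_id] at this

end LaxCell

/-! ### The automaton of lax cells -/

section Finite

variable (X : HDA α)

theorem finite_virtualCells : Finite (Σ U : LoSet α, VirtualCell X.cells U) := by
  have := X.finite
  let F : (Σ c : Cell X.cells, Σ U : LoSet α, U ⟶ c.1) → Σ U : LoSet α, VirtualCell X.cells U :=
    fun x => ⟨x.2.1, x.1.1, x.1.2, x.2.2⟩
  exact Finite.of_surjective F fun ⟨U, V, x, d⟩ => ⟨⟨⟨V, x⟩, U, d⟩, rfl⟩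

instance (U : LoSet α) : Finite (VirtualCell X.cells U) := by
  have := finite_virtualCells X
  exact Finite.of_injective (fun c => (⟨U, c⟩ : Σ U : LoSet α, VirtualCell X.cells U))
    sigma_mk_injective

instance (U : LoSet α) : Finite (LaxCell X U) :=
  Finite.of_injective
    (fun (F : LaxCell X U) (e : Σ W : LoSet α, W ⟶ U) => F.toFun e.1 e.2)
    fun _ _ h => LaxCell.ext fun W e => congrFun h ⟨W, e⟩

/-- The lax cells form a precubical set. -/
noncomputable def laxCells : PrecubicalSet α where
  -- Lax cells live in the universe of the alphabet, cells in `Type`; finiteness permits the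
  -- passage.
  obj U := Shrink.{0} (LaxCell X U.unop)
  map e := TypeCat.ofHom fun F => equivShrink _ (((equivShrink _).symm F).face e.unop)
  map_id U := by
    refine ConcreteCategory.hom_ext _ _ fun F => ?_
    simp
  map_comp e e' := by
    refine ConcreteCategory.hom_ext _ _ fun F => ?_
    simp [LaxCell.face_comp]

/-- The lax cell underlying a cell of `laxCells`. -/
noncomputable def laxCellEquiv (U : LoSet α) : (laxCells X).obj (op U) ≃ LaxCell X U :=
  (equivShrink _).symm

theorem laxCellEquiv_map {U V : LoSet α} (e : U ⟶ V) (x : (laxCells X).obj (op V)) :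
    laxCellEquiv X U ((laxCells X).map e.op x) = (laxCellEquiv X V x).face e :=
  (equivShrink _).symm_apply_apply _

theorem finite_laxCells : Finite (Cell (laxCells X)) := by
  have := finite_virtualCells X
  let I := {U : LoSet α // Nonempty (VirtualCell X.cells U)}
  have : Finite I := Finite.of_surjective
    (fun x : Σ U : LoSet α, VirtualCell X.cells U => (⟨x.1, ⟨x.2⟩⟩ : I))
    fun ⟨U, ⟨x⟩⟩ => ⟨⟨U, x⟩, rfl⟩
  let F : (Σ U : I, LaxCell X U.1) → Cell (laxCells X) :=
    fun x => ⟨x.1.1, (laxCellEquiv X _).symm x.2⟩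
  refine Finite.of_surjective F ?_
  -- Only words that carry a virtual cell can carry a lax cell, since the latter has a top; hence
  -- finitely many words occur.
  rintro ⟨U, x⟩
  exact ⟨⟨⟨U, ⟨(laxCellEquiv X U x).top⟩⟩, laxCellEquiv X U x⟩, by simp [F]⟩

/-- The automaton recognising the Kleene plus of the language of `X`. -/
noncomputable def HDA.plus : HDA α where
  cells := laxCells X
  finite := finite_laxCells X
  -- Only the top is prescribed. The other faces are unconstrained here beyond the laws of a lax
  -- cell.
  start := {c | ∃ x, (⟨c.1, x⟩ : Cell X.cells) ∈ X.start ∧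
    (laxCellEquiv X _ c.2).top = ⟨c.1, x, 𝟙 _⟩}
  -- The silent moves after the last step have no later start to absorb them, so acceptance allows
  -- for them.
  accept := {c | ∃ c', Silent X (laxCellEquiv X _ c.2).top c' ∧ IsAccepting X c'}

end Finite

/-- Following the tops along a path, an up-step of lax cells is a sequence of silent moves followed
by a start, and a down-step is an exact face by strictness. -/
theorem VAcc.of_acc {X : HDA α} {U W : LoSet α} (w : StepWord α U W) :
    ∀ x, Acc X.plus.cells X.plus.accept w x → VAcc X w (laxCellEquiv X U x).top := by
  induction w with
  | nil U => exact fun x hx => hx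
  | up a ha w ih =>
    rintro _ ⟨y, rfl, hy⟩
    refine ⟨_, ?_, ih y hy⟩
    erw [laxCellEquiv_map]
    exact LaxCell.top_face_silent _ _
  | down b hb w ih =>
    intro x hx
    have := ih _ hx
    erw [laxCellEquiv_map, LaxCell.top_face_of_A_empty _ _ hb] at this
    exact this

/-- The lax cell trails the virtual run: its top need only lead silently to the current virtual
cell. Terminations preserve this lag, and each start is realised by a lax extension. -/
theorem VAcc.acc {X : HDA α} {U W : LoSet α} (w : StepWord α U W) :
    ∀ c, VAcc X w c → ∀ x, Silent X (laxCellEquiv X U x).top c →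
      Acc X.plus.cells X.plus.accept w x := by
  induction w with
  | nil U => exact fun c ⟨c', hc, hc'⟩ x hx => ⟨c', hx.trans hc, hc'⟩
  | up a ha w ih =>
    rintro c ⟨c', hc, hc'⟩ x hx
    obtain ⟨G, hG, hG'⟩ := LaxCell.exists_extension _ a ha c' (hx.trans hc)
    refine ⟨(laxCellEquiv X _).symm G, (laxCellEquiv X _).injective ?_,
      ih c' hc' _ (by simpa using hG')⟩
    erw [laxCellEquiv_map]
    simpa using hG
  | down b hb w ih =>
    intro c hc x hx
    refine ih _ hc _ ?_
    erw [laxCellEquiv_map, LaxCell.top_face_of_A_empty _ _ hb]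
    exact hx.face b

/-! ### Sequences of accepting paths -/

/-- Passing from an accept cell to a start cell over the same lo-set. -/
def Jump (X : HDA α) {U : LoSet α} (x y : X.cells.obj (op U)) : Prop :=
  (⟨U, x⟩ : Cell X.cells) ∈ X.accept ∧ (⟨U, y⟩ : Cell X.cells) ∈ X.start

/-- `PlusAcc X w x`: some path over `w` with jumps leads from `x` to an accept cell. -/
def PlusAcc (X : HDA α) : {U W : LoSet α} → StepWord α U W → X.cells.obj (op U) → Prop
  | U, _, .nil _, x =>
    ∃ y : X.cells.obj (op U), Relation.ReflTransGen (Jump X) x y ∧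
      (⟨U, y⟩ : Cell X.cells) ∈ X.accept
  | _, _, .up (V := V) a _ w, x => ∃ y : X.cells.obj (op V),
    Relation.ReflTransGen (Jump X) x (X.cells.map a.op y) ∧ PlusAcc X w y
  | U, _, .down b _ w, x => ∃ y : X.cells.obj (op U),
    Relation.ReflTransGen (Jump X) x y ∧ PlusAcc X w (X.cells.map b.op y)

theorem PlusAcc.of_jumps {X : HDA α} {U W : LoSet α} {w : StepWord α U W}
    {x y : X.cells.obj (op U)} (h : Relation.ReflTransGen (Jump X) x y) (hy : PlusAcc X w y) :
    PlusAcc X w x := by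
  cases w with
  | nil U => exact ⟨_, h.trans hy.choose_spec.1, hy.choose_spec.2⟩
  | up a ha w => exact ⟨_, h.trans hy.choose_spec.1, hy.choose_spec.2⟩
  | down b hb w => exact ⟨_, h.trans hy.choose_spec.1, hy.choose_spec.2⟩

theorem Silent.of_jumps {X : HDA α} {U V : LoSet α} {x y : X.cells.obj (op V)}
    (h : Relation.ReflTransGen (Jump X) x y) (d : U ⟶ V) : Silent X ⟨V, x, d⟩ ⟨V, y, d⟩ :=
  Relation.ReflTransGen.lift (fun x => (⟨V, x, d⟩ : VirtualCell X.cells U))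
    (fun _ _ h => .jump d h.1 h.2) _ _ h

/-- `AlignAcc X w (x, d)`: the word `w` is aligned along `d` with a word accepted from `x`. -/
def AlignAcc (X : HDA α) {U W : LoSet α} (w : StepWord α U W) (c : VirtualCell X.cells U) : Prop :=
  ∃ (V : LoSet α) (v : StepWord α c.1 V), PlusAcc X v c.2.1 ∧ StepWord.Align w v c.2.2

/-- Each silent move extends the guessed run at its beginning: a jump leaves `v` unchanged, while
silent starts and terminations prepend a letter to `v`. -/
theorem AlignAcc.of_silent {X : HDA α} {U W : LoSet α} {w : StepWord α U W}
    {c c' : VirtualCell X.cells U} (h : Silent X c c') (hc : AlignAcc X w c') : AlignAcc X w c := by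
  induction h using Relation.ReflTransGen.head_induction_on with
  | refl => exact hc
  | head h _ ih =>
    obtain ⟨V, v, hv, hw⟩ := ih
    cases h with
    | jump d hx hy => exact ⟨V, v, hv.of_jumps (.single ⟨hx, hy⟩), hw⟩
    | start a ha y d => exact ⟨V, .up a ha v, ⟨y, .refl, hv⟩, .startRight a ha hw⟩
    | finish b hb x d => exact ⟨V, .down b hb v, ⟨x, .refl, hv⟩, .endRight b hb hw⟩

theorem VAcc.alignAcc {X : HDA α} {U W : LoSet α} (w : StepWord α U W) :
    ∀ c, VAcc X w c → AlignAcc X w c := by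
  induction w with
  | nil U =>
    rintro c ⟨_, hc, x, hx, rfl⟩
    exact AlignAcc.of_silent hc ⟨U, .nil U, ⟨x, .refl, hx⟩, .nil U⟩
  | up a ha w ih =>
    rintro c ⟨c', hc, hc'⟩
    obtain ⟨V, v, hv, hw⟩ := ih c' hc'
    exact AlignAcc.of_silent hc ⟨V, v, hv, .startLeft a ha hw⟩
  | down b hb w ih =>
    intro c hc
    obtain ⟨V, v, hv, hw⟩ := ih _ hc
    exact ⟨V, v, hv, .endLeft b hb hw⟩

/-- The alignment is read as a schedule: its right rules are silent moves and its left rules visible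
steps. -/
theorem VAcc.of_align {X : HDA α} {U W V W' : LoSet α} {w : StepWord α U W} {v : StepWord α V W'}
    {d : U ⟶ V} (h : StepWord.Align w v d) :
    ∀ x : X.cells.obj (op V), PlusAcc X v x → VAcc X w ⟨V, x, d⟩ := by
  induction h with
  | nil U => exact fun x ⟨y, hxy, hy⟩ => ⟨_, .of_jumps hxy _, y, hy, rfl⟩
  | startRight a ha h ih =>
    rintro x ⟨y, hxy, hy⟩
    exact VAcc.of_silent _ ((Silent.of_jumps hxy _).tail (.start a ha y _)) (ih y hy)
  | endRight b hb h ih =>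
    rintro x ⟨y, hxy, hy⟩
    exact VAcc.of_silent _ ((Silent.of_jumps hxy _).tail (.finish b hb y _)) (ih _ hy)
  | startLeft a ha h ih => exact fun x hx => ⟨_, .refl, ih x hx⟩
  | endLeft b hb h ih => exact fun x hx => ih x hx

/-- `PowAcc X n w x`: the word `w` is a concatenation of words of `n + 1` paths, all but the first
from a start cell, all of them to an accept cell, the first from `x`. -/
def PowAcc (X : HDA α) : ℕ → {U W : LoSet α} → StepWord α U W → X.cells.obj (op U) → Prop
  | 0, _, _, w, x => Acc X.cells X.accept w x
  | n + 1, U, W, w, x => ∃ (V : LoSet α) (w₀ : StepWord α U V) (w₁ : StepWord α V W)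
    (y : X.cells.obj (op V)), w₀.append w₁ = w ∧ Acc X.cells X.accept w₀ x ∧
      (⟨V, y⟩ : Cell X.cells) ∈ X.start ∧ PowAcc X n w₁ y

theorem Acc.plusAcc {X : HDA α} {U W : LoSet α} (w : StepWord α U W) :
    ∀ x, Acc X.cells X.accept w x → PlusAcc X w x := by
  induction w with
  | nil U => exact fun x hx => ⟨x, .refl, hx⟩
  | up a ha w ih => rintro _ ⟨y, rfl, hy⟩; exact ⟨y, .refl, ih y hy⟩
  | down b hb w ih => exact fun x hx => ⟨x, .refl, ih _ hx⟩

theorem PlusAcc.append {X : HDA α} {U V W : LoSet α} (w₀ : StepWord α U V) (w₁ : StepWord α V W)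
    {y : X.cells.obj (op V)} (hy : (⟨V, y⟩ : Cell X.cells) ∈ X.start) (h : PlusAcc X w₁ y) :
    ∀ x, Acc X.cells X.accept w₀ x → PlusAcc X (w₀.append w₁) x := by
  induction w₀ with
  | nil U => exact fun x hx => h.of_jumps (.single ⟨hx, hy⟩)
  | up a ha w ih => rintro _ ⟨z, rfl, hz⟩; exact ⟨z, .refl, ih w₁ hy h z hz⟩
  | down b hb w ih => exact fun x hx => ⟨x, .refl, ih w₁ hy h _ hx⟩

theorem PowAcc.plusAcc {X : HDA α} (n : ℕ) : ∀ {U W : LoSet α} (w : StepWord α U W)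
    (x : X.cells.obj (op U)), PowAcc X n w x → PlusAcc X w x := by
  induction n with
  | zero => exact fun w x h => Acc.plusAcc w x h
  | succ n ih =>
    rintro U W _ x ⟨V, w₀, w₁, y, rfl, hx, hy, h⟩
    exact PlusAcc.append w₀ w₁ hy (ih w₁ y h) x hx

theorem PowAcc.exists_of_jumps {X : HDA α} {U W : LoSet α} {w : StepWord α U W}
    {x y : X.cells.obj (op U)} (h : Relation.ReflTransGen (Jump X) x y)
    (hy : ∃ n, PowAcc X n w y) : ∃ n, PowAcc X n w x := by
  induction h using Relation.ReflTransGen.head_induction_on with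
  | refl => exact hy
  | head h _ ih =>
    obtain ⟨n, hn⟩ := ih
    -- Every jump cuts off a path of length zero, namely the accept cell from which it departs.
    exact ⟨n + 1, U, .nil U, w, _, rfl, h.1, h.2, hn⟩

/-- The run is cut at its jumps. A step in front is added to the first piece, and initial jumps
contribute empty pieces. -/
theorem PlusAcc.exists_powAcc {X : HDA α} {U W : LoSet α} (w : StepWord α U W) :
    ∀ x : X.cells.obj (op U), PlusAcc X w x → ∃ n, PowAcc X n w x := by
  induction w with
  | nil U => exact fun x ⟨y, hxy, hy⟩ => PowAcc.exists_of_jumps hxy ⟨0, hy⟩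
  | up a ha w ih =>
    rintro x ⟨y, hxy, hy⟩
    refine PowAcc.exists_of_jumps hxy ?_
    obtain ⟨n, hn⟩ := ih y hy
    cases n with
    | zero => exact ⟨0, y, rfl, hn⟩
    | succ n =>
      obtain ⟨V, w₀, w₁, z, rfl, h₀, hz, h₁⟩ := hn
      exact ⟨n + 1, V, .up a ha w₀, w₁, z, rfl, ⟨y, rfl, h₀⟩, hz, h₁⟩
  | down b hb w ih =>
    rintro x ⟨y, hxy, hy⟩
    refine PowAcc.exists_of_jumps hxy ?_
    obtain ⟨n, hn⟩ := ih _ hy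
    cases n with
    | zero => exact ⟨0, hn⟩
    | succ n =>
      obtain ⟨V, w₀, w₁, z, rfl, h₀, hz, h₁⟩ := hn
      exact ⟨n + 1, V, .down b hb w₀, w₁, z, rfl, h₀, hz, h₁⟩

/-- The automaton `X.plus` accepts the words aligned with concatenations of words accepted
by `X`. -/
theorem exists_acc_plus_iff {X : HDA α} {U W : LoSet α} (w : StepWord α U W) :
    (∃ x, (⟨U, x⟩ : Cell X.plus.cells) ∈ X.plus.start ∧ Acc X.plus.cells X.plus.accept w x) ↔
      ∃ (x : X.cells.obj (op U)) (V : LoSet α) (v : StepWord α U V) (n : ℕ),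
        (⟨U, x⟩ : Cell X.cells) ∈ X.start ∧ PowAcc X n v x ∧ StepWord.Align w v (𝟙 U) := by
  constructor
  · rintro ⟨c, ⟨x, hx, hc⟩, hw⟩
    have h := VAcc.of_acc w c hw
    dsimp only at hc
    rw [hc] at h
    obtain ⟨V, v, hv, hwv⟩ := VAcc.alignAcc w _ h
    obtain ⟨n, hn⟩ := PlusAcc.exists_powAcc v _ hv
    exact ⟨x, V, v, n, hx, hn, hwv⟩
  · rintro ⟨x, V, v, n, hx, hv, hwv⟩
    refine ⟨(laxCellEquiv X U).symm (.ofVirtual ⟨U, x, 𝟙 U⟩), ⟨x, hx, by simp⟩,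
      VAcc.acc w _ (VAcc.of_align hwv x (hv.plusAcc n)) _ ?_⟩
    simp
    rfl

/-! ### Concurrency, and interfaces given by embeddings of lo-sets -/

namespace Iposet

variable {U V : LoSet α} {P Q R : Iposet α}

/-- `x` and `y` are incomparable with respect to precedence. -/
def Conc (P : Iposet α) (x y : P.carrier) : Prop := ¬ P.prec x y ∧ ¬ P.prec y x

theorem event_asymm (P : Iposet α) {x y : P.carrier} (h : P.event x y) : ¬ P.event y x :=
  fun h' => P.event_irrefl _ (P.event_trans _ _ _ h h')

theorem event_trichotomy (P : Iposet α) {x y : P.carrier} (h : P.Conc x y) :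
    x = y ∨ P.event x y ∨ P.event y x := by
  have := P.comparable x y
  have h1 := h.1
  have h2 := h.2
  tauto

theorem conc_of_S (P : Iposet α) {x y : P.carrier} (hx : x ∈ P.S) (hy : y ∈ P.S) : P.Conc x y :=
  ⟨P.S_minimal y hy x, P.S_minimal x hx y⟩

theorem conc_of_T (P : Iposet α) {x y : P.carrier} (hx : x ∈ P.T) (hy : y ∈ P.T) : P.Conc x y :=
  ⟨P.T_maximal x hx y, P.T_maximal y hy x⟩

/-- A map that preserves events of concurrent elements also reflects them. -/
theorem event_of_event_map {f : P.carrier → Q.carrier}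
    (hf : ∀ x y, P.event x y → P.Conc x y → Q.event (f x) (f y)) {x y : P.carrier}
    (hc : P.Conc x y) (h : Q.event (f x) (f y)) : P.event x y := by
  rcases P.event_trichotomy hc with rfl | h' | h'
  · exact (Q.event_irrefl _ h).elim
  · exact h'
  · exact (Q.event_asymm h (hf _ _ h' hc.symm)).elim

namespace Marking

variable {I : Set P.carrier}

/-- The events of a marked interface. -/
def emb (s : Marking U P I) (k : Fin U.size) : P.carrier := s.equiv k

theorem emb_mem (s : Marking U P I) (k : Fin U.size) : s.emb k ∈ I := (s.equiv k).2

theorem exists_emb (s : Marking U P I) {x : P.carrier} (hx : x ∈ I) : ∃ k, s.emb k = x :=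
  ⟨s.equiv.symm ⟨x, hx⟩, by simp [emb]⟩

theorem emb_injective (s : Marking U P I) : Function.Injective s.emb :=
  Subtype.val_injective.comp s.equiv.injective

theorem emb_event (s : Marking U P I) {i j : Fin U.size} :
    P.event (s.emb i) (s.emb j) ↔ i < j := (s.event_iff i j).symm

theorem emb_label (s : Marking U P I) (i : Fin U.size) : P.label (s.emb i) = U.label i :=
  s.label_eq i

/-- A marking given by its embedding. -/
noncomputable def ofEmb (f : Fin U.size → P.carrier) (hI : ∀ x, x ∈ I ↔ ∃ k, f k = x)
    (he : ∀ i j, i < j ↔ P.event (f i) (f j)) (hl : ∀ i, P.label (f i) = U.label i) :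
    Marking U P I where
  equiv := Equiv.ofBijective (fun k => ⟨f k, (hI _).2 ⟨k, rfl⟩⟩) (by
    constructor
    · intro i j hij
      have h : f i = f j := congrArg Subtype.val hij
      rcases lt_trichotomy i j with h' | h' | h'
      · have := (he _ _).1 h'
        rw [h] at this
        exact (P.event_irrefl _ this).elim
      · exact h'
      · have := (he _ _).1 h'
        rw [h] at this
        exact (P.event_irrefl _ this).elim
    · rintro ⟨x, hx⟩
      obtain ⟨k, rfl⟩ := (hI x).1 hx
      exact ⟨k, rfl⟩)
  event_iff := he
  label_eq := hl

theorem inR_matching (s : Marking U P P.T) (t : Marking U Q Q.S) (k : Fin U.size) :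
    (s.matching t).inR (t.emb k) = Sum.inl (s.emb k) := by
  have : t.emb k = (s.matching t).equiv (s.equiv k) := by simp [matching, emb]
  rw [this, Matching.inR_equiv]
  rfl

end Marking

/-! ### Gluing a step in front of an iposet -/

/-- `R` arises from `P` by removing from the source interface the events outside the range
of `a`, i.e. by gluing a starting step in front. -/
structure StartExt (s : Marking U R R.S) (t : Marking V P P.S) (a : U ⟶ V)
    (j : P.carrier → R.carrier) : Prop where
  bij : Function.Bijective j
  label : ∀ x, R.label (j x) = P.label x
  prec : ∀ x y, R.prec (j x) (j y) ↔ P.prec x y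
  event : ∀ x y, P.event x y → P.Conc x y → R.event (j x) (j y)
  src : ∀ k, s.emb k = j (t.emb (Coface.map a k))
  tgt : ∀ x, j x ∈ R.T ↔ x ∈ P.T

/-- `R` arises from `P` by gluing a terminating step in front. -/
structure EndExt (s : Marking U R R.S) (t : Marking V P P.S) (b : V ⟶ U)
    (j : P.carrier → R.carrier) : Prop where
  inj : Function.Injective j
  label : ∀ x, R.label (j x) = P.label x
  prec : ∀ x y, R.prec (j x) (j y) ↔ P.prec x y
  event : ∀ x y, P.event x y → P.Conc x y → R.event (j x) (j y)
  src : ∀ k, s.emb (Coface.map b k) = j (t.emb k)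
  tgt : ∀ x, j x ∈ R.T ↔ x ∈ P.T
  cover : ∀ r, (∃ x, j x = r) ∨ ∃ k, k ∈ Coface.B b ∧ s.emb k = r
  new : ∀ k ∈ Coface.B b, (∀ x, j x ≠ s.emb k) ∧ s.emb k ∉ R.T
  prec_new : ∀ k ∈ Coface.B b, ∀ x, x ∉ P.S → R.prec (s.emb k) (j x)

variable (f : Matching P Q)

theorem glue_prec_inl (x y : P.carrier) :
    (P.glue Q f).prec (Sum.inl x) (Sum.inl y) ↔ P.prec x y := by
  constructor
  · rintro (⟨a, b, h, e, e'⟩ | ⟨a, b, h, e, e'⟩ | ⟨a, b, ha, hb, e, e'⟩)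
    · cases e; cases e'; exact h
    · exact (Q.S_minimal _ (f.inR_eq_inl e').2 _ h).elim
    · exact (hb (f.inR_eq_inl e').2).elim
  · exact fun h => Or.inl ⟨x, y, h, rfl, rfl⟩

theorem glue_prec_inR (x y : Q.carrier) :
    (P.glue Q f).prec (f.inR x) (f.inR y) ↔ Q.prec x y := by
  constructor
  · rintro (⟨a, b, h, e, e'⟩ | ⟨a, b, h, e, e'⟩ | ⟨a, b, ha, hb, e, e'⟩)
    · exact (P.T_maximal _ (f.inR_eq_inl e.symm).1 _ h).elim
    · rw [← f.inR_injective e, ← f.inR_injective e']; exact h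
    · exact (ha (f.inR_eq_inl e.symm).1).elim
  · exact fun h => Or.inr (Or.inl ⟨x, y, h, rfl, rfl⟩)

theorem glue_prec_inl_inR {x : P.carrier} {y : Q.carrier} (hx : x ∉ P.T) (hy : y ∉ Q.S) :
    (P.glue Q f).prec (Sum.inl x) (f.inR y) :=
  Or.inr (Or.inr ⟨x, y, hx, hy, rfl, rfl⟩)

theorem glue_event_inl {x y : P.carrier} (h : P.event x y) :
    (P.glue Q f).event (Sum.inl x) (Sum.inl y) :=
  .single (Or.inl ⟨x, y, h, rfl, rfl⟩)

theorem glue_event_inR {x y : Q.carrier} (h : Q.event x y) :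
    (P.glue Q f).event (f.inR x) (f.inR y) :=
  .single (Or.inr ⟨x, y, h, rfl, rfl⟩)

/-- Unlike the representatives in `GlueCarrier`, this covering counts the shared interface as part
of `Q`, which suits gluing a step in front of a known iposet. -/
theorem glue_cover (r : (P.glue Q f).carrier) :
    (∃ q, f.inR q = r) ∨ ∃ p, p ∉ P.T ∧ Sum.inl p = r := by
  rcases r with p | q
  · by_cases hp : p ∈ P.T
    · exact Or.inl ⟨f.equiv ⟨p, hp⟩, f.inR_equiv ⟨p, hp⟩⟩
    · exact Or.inr ⟨p, hp, rfl⟩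
  · exact Or.inl ⟨q, f.inR_of_notMem q.2⟩

theorem glue_label_inR (q : Q.carrier) : (P.glue Q f).label (f.inR q) = Q.label q := by
  rcases f.inR_cases q with ⟨h, e⟩ | ⟨t, rfl, e⟩
  · rw [e]; rfl
  · rw [e, f.label_eq]; rfl

theorem glue_tgt_inR (q : Q.carrier) : f.inR q ∈ (P.glue Q f).T ↔ q ∈ Q.T :=
  f.inR_injective.mem_set_image

end Iposet

/-! ### Iposets of step words -/

namespace StepWord

open Iposet

/-- The iposet of a step word, with its source interface. -/
noncomputable def evAux : {U W : LoSet α} → StepWord α U W →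
    Σ P : Iposet α, Marking U P P.S
  | _, _, .nil U => ⟨discrete U Set.univ Set.univ, Marking.univ _ _ _⟩
  | _, _, .up (V := V) a _ w =>
    let f : Matching (discrete V (Set.range (Coface.map a)) Set.univ) w.evAux.1 :=
      (Marking.univ V (Set.range (Coface.map a)) Set.univ).matching w.evAux.2
    ⟨Iposet.glue _ _ f, (Marking.range a _ _).glue f⟩
  | U, _, .down b _ w =>
    let f : Matching (discrete U Set.univ (Set.range (Coface.map b))) w.evAux.1 :=
      (Marking.range b Set.univ (Set.range (Coface.map b))).matching w.evAux.2
    ⟨Iposet.glue _ _ f, (Marking.univ U Set.univ _).glue f⟩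

/-- The iposet of a step word. -/
noncomputable abbrev iposet {U W : LoSet α} (w : StepWord α U W) : Iposet α := w.evAux.1

/-- The source interface of the iposet of a step word. -/
noncomputable abbrev src {U W : LoSet α} (w : StepWord α U W) :
    Marking U w.iposet w.iposet.S := w.evAux.2

/-- The map is the structural inclusion of the second factor. It is onto because the target
interface of a starting step is everything. -/
theorem startExt {U V W : LoSet α} (a : U ⟶ V) (ha : Coface.B a = ∅) (w : StepWord α V W) :
    ∃ j, StartExt (up a ha w).src w.src a j := by
  refine ⟨Matching.inR ((Marking.univ V (Set.range (Coface.map a)) Set.univ).matching w.evAux.2),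
    ⟨Matching.inR_injective _, fun r => ?_⟩, glue_label_inR _, glue_prec_inR _,
    fun x y h _ => glue_event_inR _ h, fun k => ?_, glue_tgt_inR _⟩
  · rcases glue_cover _ r with h | ⟨p, hp, -⟩
    · exact h
    · exact (hp (Set.mem_univ p)).elim
  · exact (Marking.inR_matching (Marking.univ V _ _) w.src (Coface.map a k)).symm

/-- The structural inclusion of the second factor misses exactly the terminated events, which
precede everything outside the source interface of that factor. -/
theorem endExt {U V W : LoSet α} (b : V ⟶ U) (hb : Coface.A b = ∅) (w : StepWord α V W) :
    ∃ j, EndExt (down b hb w).src w.src b j := by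
  have hr : ∀ k, k ∈ Coface.B b ↔ k ∉ Set.range (Coface.map b) := fun k => by
    rw [Coface.mem_range_iff b k, hb]; simp
  refine ⟨Matching.inR ((Marking.range b Set.univ (Set.range (Coface.map b))).matching w.evAux.2),
    Matching.inR_injective _, glue_label_inR _, glue_prec_inR _,
    fun x y h _ => glue_event_inR _ h, fun k => ?_, glue_tgt_inR _, fun r => ?_,
    fun k hk => ⟨?_, ?_⟩,
    fun k hk x hx => ?_⟩
  · exact (Marking.inR_matching (P := discrete U Set.univ (Set.range (Coface.map b)))
      (Marking.range b _ _) w.src k).symm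
  · rcases glue_cover _ r with h | ⟨p, hp, h⟩
    · exact Or.inl h
    · exact Or.inr ⟨p, (hr p).2 hp, h⟩
  · intro x hx
    exact (hr k).1 hk (Matching.inR_eq_inl _ hx).1
  · rintro ⟨x, -, hx⟩
    exact (hr k).1 hk (Matching.inR_eq_inl _ hx).1
  · exact glue_prec_inl_inR _ ((hr k).1 hk) hx

end StepWord

/-! ### Partial subsumptions and their behaviour under steps -/

namespace Iposet

variable {U U₁ V V₁ : LoSet α} {P P₁ Q Q₁ : Iposet α}

/-- Subsumption relative to delayed and advanced events: the events of `P` are those of `Q` except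
for the ones in `B` of the coface map `d` relating the source interfaces. -/
structure PartialSub (s : Marking U P P.S) (t : Marking V Q Q.S) (d : U ⟶ V)
    (f : P.carrier → Q.carrier) : Prop where
  inj : Function.Injective f
  label : ∀ x, Q.label (f x) = P.label x
  prec : ∀ x y, Q.prec (f x) (f y) → P.prec x y
  event : ∀ x y, P.event x y → P.Conc x y → Q.event (f x) (f y)
  src : ∀ k, f (s.emb k) = t.emb (Coface.map d k)
  tgt : ∀ x, f x ∈ Q.T ↔ x ∈ P.T
  cover : ∀ y, (∃ x, f x = y) ∨ ∃ k ∈ Coface.B d, t.emb k = y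
  new : ∀ k ∈ Coface.B d, (∀ x, f x ≠ t.emb k) ∧ t.emb k ∉ Q.T

namespace PartialSub

variable {s : Marking U P P.S} {t : Marking V Q Q.S} {s₁ : Marking U₁ P₁ P₁.S}
  {t₁ : Marking V₁ Q₁ Q₁.S}

theorem conc {d : U ⟶ V} {f : P.carrier → Q.carrier} (h : PartialSub s t d f) {x y : P.carrier}
    (hc : P.Conc x y) : Q.Conc (f x) (f y) :=
  ⟨fun h' => hc.1 (h.prec _ _ h'), fun h' => hc.2 (h.prec _ _ h')⟩

/-! #### Steps of the second iposet -/

theorem startRight {a : V ⟶ V₁} (ha : Coface.B a = ∅) {j : Q₁.carrier → Q.carrier}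
    (hj : StartExt t t₁ a j) {d : U ⟶ V} {f : P.carrier → Q₁.carrier}
    (h : PartialSub s t₁ (d ≫ a) f) : PartialSub s t d (j ∘ f) where
  inj := hj.bij.1.comp h.inj
  label x := by simp [hj.label, h.label]
  prec x y hxy := h.prec _ _ ((hj.prec _ _).1 hxy)
  event x y hxy hc := hj.event _ _ (h.event _ _ hxy hc) (h.conc hc)
  src k := by rw [Function.comp_apply, h.src, hj.src]; rfl
  tgt x := (hj.tgt _).trans (h.tgt x)
  cover y := by
    obtain ⟨y, rfl⟩ := hj.bij.2 y
    rcases h.cover y with ⟨x, rfl⟩ | ⟨k, hk, rfl⟩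
    · exact Or.inl ⟨x, rfl⟩
    · rw [Coface.comp_B, ha, Set.union_empty] at hk
      obtain ⟨k, hk, rfl⟩ := hk
      exact Or.inr ⟨k, hk, hj.src k⟩
  new k hk := by
    have := h.new (Coface.map a k) (Or.inl ⟨k, hk, rfl⟩)
    rw [hj.src, hj.tgt]
    exact ⟨fun x hx => this.1 x (hj.bij.1 hx), this.2⟩

theorem of_startRight {a : V ⟶ V₁} (ha : Coface.B a = ∅) {j : Q₁.carrier → Q.carrier}
    (hj : StartExt t t₁ a j) {d : U ⟶ V} {f : P.carrier → Q.carrier}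
    (h : PartialSub s t d f) : ∃ f₁, PartialSub s t₁ (d ≫ a) f₁ := by
  choose f₁ hf₁ using fun x => hj.bij.2 (f x)
  obtain rfl : j ∘ f₁ = f := funext hf₁
  have hconc : ∀ {x y}, P.Conc x y → Q₁.Conc (f₁ x) (f₁ y) := fun hc =>
    ⟨fun h' => (h.conc hc).1 ((hj.prec _ _).2 h'), fun h' => (h.conc hc).2 ((hj.prec _ _).2 h')⟩
  refine ⟨f₁, ?_, ?_, ?_, ?_, ?_, ?_, ?_, ?_⟩
  · exact h.inj.of_comp
  · exact fun x => by rw [← hj.label, ← h.label]; rfl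
  · exact fun x y hxy => h.prec _ _ ((hj.prec _ _).2 hxy)
  · exact fun x y hxy hc => event_of_event_map hj.event (hconc hc) (h.event _ _ hxy hc)
  · exact fun k => hj.bij.1 ((h.src k).trans (hj.src _))
  · exact fun x => (hj.tgt _).symm.trans (h.tgt x)
  · intro y
    rcases h.cover (j y) with ⟨x, hx⟩ | ⟨k, hk, hy⟩
    · exact Or.inl ⟨x, hj.bij.1 hx⟩
    · exact Or.inr ⟨Coface.map a k, Or.inl ⟨k, hk, rfl⟩, hj.bij.1 ((hj.src k).symm.trans hy)⟩
  · intro k hk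
    rw [Coface.comp_B, ha, Set.union_empty] at hk
    obtain ⟨k, hk, rfl⟩ := hk
    have := h.new k hk
    rw [hj.src, hj.tgt] at this
    exact ⟨fun x hx => this.1 x (congrArg j hx), this.2⟩

theorem endRight {b : V₁ ⟶ V} {j : Q₁.carrier → Q.carrier}
    (hj : EndExt t t₁ b j) {d : U ⟶ V₁} {f : P.carrier → Q₁.carrier}
    (h : PartialSub s t₁ d f) : PartialSub s t (d ≫ b) (j ∘ f) where
  inj := hj.inj.comp h.inj
  label x := by simp [hj.label, h.label]
  prec x y hxy := h.prec _ _ ((hj.prec _ _).1 hxy)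
  event x y hxy hc := hj.event _ _ (h.event _ _ hxy hc) (h.conc hc)
  src k := by rw [Function.comp_apply, h.src, Coface.comp_map, hj.src]
  tgt x := (hj.tgt _).trans (h.tgt x)
  cover y := by
    rcases hj.cover y with ⟨y, rfl⟩ | ⟨k, hk, rfl⟩
    · rcases h.cover y with ⟨x, rfl⟩ | ⟨k, hk, rfl⟩
      · exact Or.inl ⟨x, rfl⟩
      · exact Or.inr ⟨_, Or.inl ⟨k, hk, rfl⟩, hj.src k⟩
    · exact Or.inr ⟨k, Or.inr hk, rfl⟩
  new k hk := by
    rcases hk with ⟨k, hk, rfl⟩ | hk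
    · have := h.new k hk
      rw [hj.src, hj.tgt]
      exact ⟨fun x hx => this.1 x (hj.inj hx), this.2⟩
    · have := hj.new k hk
      exact ⟨fun x => this.1 _, this.2⟩

/-- The inclusion `hd` says that the events terminated by this step have already been terminated on
the left. Hence `f` avoids them and factors through the rest of `Q`. -/
theorem of_endRight {b : V₁ ⟶ V} (hb : Coface.A b = ∅) {j : Q₁.carrier → Q.carrier}
    (hj : EndExt t t₁ b j) {d : U ⟶ V} {f : P.carrier → Q.carrier} (h : PartialSub s t d f)
    (hd : Coface.B b ⊆ Coface.B d) : ∃ d₁ f₁, d₁ ≫ b = d ∧ PartialSub s t₁ d₁ f₁ := by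
  obtain ⟨d, rfl⟩ := Coface.exists_factor d b (by simp [hb]) hd
  have hex : ∀ x, ∃ y, j y = f x := fun x => by
    rcases hj.cover (f x) with hy | ⟨k, hk, hx⟩
    · exact hy
    · exact ((h.new k (hd hk)).1 x hx.symm).elim
  choose f₁ hf₁ using hex
  obtain rfl : j ∘ f₁ = f := funext hf₁
  have hconc : ∀ {x y}, P.Conc x y → Q₁.Conc (f₁ x) (f₁ y) := fun hc =>
    ⟨fun h' => (h.conc hc).1 ((hj.prec _ _).2 h'), fun h' => (h.conc hc).2 ((hj.prec _ _).2 h')⟩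
  refine ⟨d, f₁, rfl, ?_, ?_, ?_, ?_, ?_, ?_, ?_, ?_⟩
  · exact h.inj.of_comp
  · exact fun x => by rw [← hj.label, ← h.label]; rfl
  · exact fun x y hxy => h.prec _ _ ((hj.prec _ _).2 hxy)
  · exact fun x y hxy hc => event_of_event_map hj.event (hconc hc) (h.event _ _ hxy hc)
  · exact fun k => hj.inj ((h.src k).trans (hj.src _))
  · exact fun x => (hj.tgt _).symm.trans (h.tgt x)
  · intro y
    rcases h.cover (j y) with ⟨x, hx⟩ | ⟨k, ⟨k, hk, rfl⟩ | hk, hy⟩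
    · exact Or.inl ⟨x, hj.inj hx⟩
    · exact Or.inr ⟨k, hk, hj.inj ((hj.src k).symm.trans hy)⟩
    · exact ((hj.new k hk).1 _ hy.symm).elim
  · intro k hk
    have := h.new _ (Or.inl ⟨k, hk, rfl⟩)
    rw [hj.src, hj.tgt] at this
    exact ⟨fun x hx => this.1 x (congrArg j hx), this.2⟩

/-! #### Steps of the first iposet -/

theorem startLeft {a : U ⟶ U₁} {j : P₁.carrier → P.carrier}
    (hj : StartExt s s₁ a j) (ha : Coface.B a = ∅) {d : U₁ ⟶ V} {f : P₁.carrier → Q.carrier}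
    (h : PartialSub s₁ t d f) : ∃ f', PartialSub s t (a ≫ d) f' := by
  let e := Equiv.ofBijective j hj.bij
  have he : ∀ x, e.symm (j x) = x := fun x => e.symm_apply_apply x
  have hconc : ∀ {x y}, P.Conc (j x) (j y) → P₁.Conc x y := fun hc =>
    ⟨fun h' => hc.1 ((hj.prec _ _).2 h'), fun h' => hc.2 ((hj.prec _ _).2 h')⟩
  refine ⟨f ∘ e.symm, h.inj.comp e.symm.injective, ?_, ?_, ?_, ?_, ?_, ?_, ?_⟩
  · intro x
    obtain ⟨x, rfl⟩ := hj.bij.2 x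
    simp [he, h.label, hj.label]
  · intro x y
    obtain ⟨x, rfl⟩ := hj.bij.2 x
    obtain ⟨y, rfl⟩ := hj.bij.2 y
    simp only [Function.comp_apply, he, hj.prec]
    exact h.prec x y
  · intro x y
    obtain ⟨x, rfl⟩ := hj.bij.2 x
    obtain ⟨y, rfl⟩ := hj.bij.2 y
    simp only [Function.comp_apply, he]
    exact fun hxy hc => h.event _ _ (event_of_event_map hj.event (hconc hc) hxy) (hconc hc)
  · intro k
    rw [hj.src, Function.comp_apply, he, h.src]
    rfl
  · intro x
    obtain ⟨x, rfl⟩ := hj.bij.2 x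
    rw [Function.comp_apply, he, h.tgt, hj.tgt]
  · intro y
    rw [Coface.comp_B, ha, Set.image_empty, Set.empty_union]
    rcases h.cover y with ⟨x, rfl⟩ | hk
    · exact Or.inl ⟨j x, by simp [he]⟩
    · exact Or.inr hk
  · rw [Coface.comp_B, ha, Set.image_empty, Set.empty_union]
    exact fun k hk => ⟨fun x => (h.new k hk).1 _, (h.new k hk).2⟩

/-- The condition `hS` says that all events active after the start are already active in `Q`; this
is what allows `d` to be extended over the newly started events. -/
theorem of_startLeft {a : U ⟶ U₁} (ha : Coface.B a = ∅) {j : P₁.carrier → P.carrier}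
    (hj : StartExt s s₁ a j) {d : U ⟶ V} {f : P.carrier → Q.carrier} (h : PartialSub s t d f)
    (hS : ∀ k, f (j (s₁.emb k)) ∈ Q.S) : ∃ d₁ f₁, a ≫ d₁ = d ∧ PartialSub s₁ t d₁ f₁ := by
  choose g hg using fun k => t.exists_emb (hS k)
  have hlt : ∀ {k l}, k < l → g k < g l := by
    intro k l hkl
    have hc := P₁.conc_of_S (s₁.emb_mem k) (s₁.emb_mem l)
    rw [← t.emb_event, hg, hg]
    refine h.event _ _ (hj.event _ _ (s₁.emb_event.2 hkl) hc) ⟨?_, ?_⟩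
    · rw [hj.prec]; exact hc.1
    · rw [hj.prec]; exact hc.2
  have hgB : ∀ k, g k ∉ Coface.B d := fun k hk => (h.new _ hk).1 _ (hg k).symm
  let d₁ : U₁ ⟶ V := Coface.ofMap g (fun _ _ => hlt)
    (fun k => by rw [← t.emb_label, hg, h.label, hj.label, s₁.emb_label]) (Coface.B d) hgB
  have hd₁ : ∀ k, Coface.map d₁ k = g k := fun k => rfl
  have hd₁B : Coface.B d₁ = Coface.B d := rfl
  refine ⟨d₁, f ∘ j, Coface.ext_map_B (fun k => t.emb_injective ?_) ?_, ?_⟩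
  · rw [Coface.comp_map, hd₁, hg, ← hj.src, h.src]
  · rw [Coface.comp_B, ha, Set.image_empty, Set.empty_union, hd₁B]
  · refine ⟨h.inj.comp hj.bij.1, ?_, ?_, ?_, ?_, ?_, ?_, ?_⟩
    · exact fun x => by simp [h.label, hj.label]
    · exact fun x y hxy => (hj.prec _ _).1 (h.prec _ _ hxy)
    · intro x y hxy hc
      refine h.event _ _ (hj.event _ _ hxy hc) ⟨?_, ?_⟩
      · rw [hj.prec]; exact hc.1
      · rw [hj.prec]; exact hc.2
    · exact fun k => (hg k).symm
    · exact fun x => (h.tgt _).trans (hj.tgt x)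
    · intro y
      rcases h.cover y with ⟨x, rfl⟩ | hk
      · obtain ⟨x, rfl⟩ := hj.bij.2 x
        exact Or.inl ⟨x, rfl⟩
      · exact Or.inr hk
    · exact fun k hk => ⟨fun x => (h.new k hk).1 _, (h.new k hk).2⟩

theorem of_endLeft {b : U₁ ⟶ U} {j : P₁.carrier → P.carrier}
    (hj : EndExt s s₁ b j) {d : U ⟶ V} {f : P.carrier → Q.carrier} (h : PartialSub s t d f) :
    PartialSub s₁ t (b ≫ d) (f ∘ j) where
  inj := h.inj.comp hj.inj
  label x := by simp [hj.label, h.label]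
  prec x y hxy := (hj.prec _ _).1 (h.prec _ _ hxy)
  event x y hxy hc := h.event _ _ (hj.event _ _ hxy hc)
    ⟨fun h' => hc.1 ((hj.prec _ _).1 h'), fun h' => hc.2 ((hj.prec _ _).1 h')⟩
  src k := by rw [Function.comp_apply, ← hj.src, h.src]; rfl
  tgt x := (h.tgt _).trans (hj.tgt x)
  cover y := by
    rcases h.cover y with ⟨x, rfl⟩ | ⟨k, hk, rfl⟩
    · rcases hj.cover x with ⟨x, rfl⟩ | ⟨k, hk, rfl⟩
      · exact Or.inl ⟨x, rfl⟩
      · exact Or.inr ⟨_, Or.inl ⟨k, hk, rfl⟩, (h.src k).symm⟩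
    · exact Or.inr ⟨k, Or.inr hk, rfl⟩
  new k hk := by
    rcases hk with ⟨k, hk, rfl⟩ | hk
    · rw [← h.src, h.tgt]
      exact ⟨fun x hx => (hj.new k hk).1 _ (h.inj hx), (hj.new k hk).2⟩
    · exact ⟨fun x => (h.new k hk).1 _, (h.new k hk).2⟩

/-- The map is extended to the terminated events by sending them to the corresponding source events
of `Q`. These are free, because `B` of `b ≫ d` contains them and `f₁` avoids them. -/
theorem endLeft {b : U₁ ⟶ U} (hb : Coface.A b = ∅) {j : P₁.carrier → P.carrier}
    (hj : EndExt s s₁ b j) {d : U ⟶ V} {f₁ : P₁.carrier → Q.carrier}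
    (h : PartialSub s₁ t (b ≫ d) f₁) : ∃ f, PartialSub s t d f := by
  have hex : ∃ f : P.carrier → Q.carrier, (∀ x, f (j x) = f₁ x) ∧
      ∀ k ∈ Coface.B b, f (s.emb k) = t.emb (Coface.map d k) := by
    have : ∀ r, ∃ y, (∀ x, j x = r → y = f₁ x) ∧
        ∀ k ∈ Coface.B b, s.emb k = r → y = t.emb (Coface.map d k) := by
      intro r
      rcases hj.cover r with ⟨x, rfl⟩ | ⟨k, hk, rfl⟩
      · refine ⟨f₁ x, fun x' hx' => by rw [hj.inj hx'], fun k hk hkx => ?_⟩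
        exact ((hj.new k hk).1 x hkx.symm).elim
      · refine ⟨t.emb (Coface.map d k), fun x hx => ((hj.new k hk).1 x hx).elim,
          fun l hl hlk => ?_⟩
        rw [s.emb_injective hlk]
    choose f hf using this
    exact ⟨f, fun x => (hf _).1 x rfl, fun k hk => (hf _).2 k hk rfl⟩
  obtain ⟨f, hf₁, hf₂⟩ := hex
  have hsrc : ∀ k, f (s.emb k) = t.emb (Coface.map d k) := by
    intro k
    by_cases hk : k ∈ Coface.B b
    · exact hf₂ k hk
    · obtain ⟨i, rfl⟩ := (b.mem_range_iff k).2 ⟨by simp [hb], hk⟩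
      rw [hj.src, hf₁, h.src]
      rfl
  -- An event being terminated precedes everything not yet started, so it is concurrent only with
  -- source events. Event-order conditions involving it thus follow from monotonicity of `d`.
  have hS : ∀ k ∈ Coface.B b, ∀ y, P.Conc (s.emb k) y → ∃ l, s.emb l = y := by
    intro k hk y hc
    rcases hj.cover y with ⟨y, rfl⟩ | ⟨l, -, rfl⟩
    · by_cases hy : y ∈ P₁.S
      · obtain ⟨i, rfl⟩ := s₁.exists_emb hy
        exact ⟨_, hj.src i⟩
      · exact (hc.1 (hj.prec_new k hk y hy)).elim
    · exact ⟨l, rfl⟩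
  have hSS : ∀ k l, P.event (s.emb k) (s.emb l) → Q.event (f (s.emb k)) (f (s.emb l)) := by
    intro k l hkl
    rw [hsrc, hsrc, t.emb_event]
    exact (Coface.map d).strictMono (s.emb_event.1 hkl)
  have hnew : ∀ k ∈ Coface.B b, ∀ x, f₁ x ≠ t.emb (Coface.map d k) := fun k hk =>
    (h.new _ (Or.inl ⟨k, hk, rfl⟩)).1
  refine ⟨f, ?_, ?_, ?_, ?_, hsrc, ?_, ?_, ?_⟩
  · intro x y hxy
    rcases hj.cover x with ⟨x, rfl⟩ | ⟨k, hk, rfl⟩ <;>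
      rcases hj.cover y with ⟨y, rfl⟩ | ⟨l, hl, rfl⟩
    · rw [hf₁, hf₁] at hxy
      rw [h.inj hxy]
    · rw [hf₁, hsrc] at hxy
      exact (hnew l hl _ hxy).elim
    · rw [hf₁, hsrc] at hxy
      exact (hnew k hk _ hxy.symm).elim
    · rw [hsrc, hsrc] at hxy
      rw [(Coface.map d).injective (t.emb_injective hxy)]
  · intro x
    rcases hj.cover x with ⟨x, rfl⟩ | ⟨k, hk, rfl⟩
    · rw [hf₁, h.label, hj.label]
    · rw [hsrc, t.emb_label, s.emb_label, d.label_map]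
  · intro x y hxy
    rcases hj.cover y with ⟨y, rfl⟩ | ⟨l, hl, rfl⟩
    · rcases hj.cover x with ⟨x, rfl⟩ | ⟨k, hk, rfl⟩
      · rw [hf₁, hf₁] at hxy
        exact (hj.prec _ _).2 (h.prec _ _ hxy)
      · refine hj.prec_new k hk y fun hy => ?_
        obtain ⟨i, rfl⟩ := s₁.exists_emb hy
        rw [hf₁, h.src] at hxy
        exact Q.S_minimal _ (t.emb_mem _) _ hxy
    · rw [hsrc] at hxy
      exact (Q.S_minimal _ (t.emb_mem _) _ hxy).elim
  · intro x y hxy hc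
    rcases hj.cover x with ⟨x, rfl⟩ | ⟨k, hk, rfl⟩
    · rcases hj.cover y with ⟨y, rfl⟩ | ⟨l, hl, rfl⟩
      · rw [hf₁, hf₁]
        have hc' : P₁.Conc x y :=
          ⟨fun h' => hc.1 ((hj.prec _ _).2 h'), fun h' => hc.2 ((hj.prec _ _).2 h')⟩
        exact h.event _ _ (event_of_event_map hj.event hc' hxy) hc'
      · obtain ⟨k, hk⟩ := hS l hl _ hc.symm
        rw [← hk] at hxy ⊢
        exact hSS _ _ hxy
    · obtain ⟨l, rfl⟩ := hS k hk _ hc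
      exact hSS _ _ hxy
  · intro x
    rcases hj.cover x with ⟨x, rfl⟩ | ⟨k, hk, rfl⟩
    · rw [hf₁, h.tgt, hj.tgt]
    · rw [hsrc]
      exact iff_of_false (h.new _ (Or.inl ⟨k, hk, rfl⟩)).2 (hj.new k hk).2
  · intro y
    rcases h.cover y with ⟨x, rfl⟩ | ⟨_, ⟨k, hk, rfl⟩ | hk, rfl⟩
    · exact Or.inl ⟨_, hf₁ x⟩
    · exact Or.inl ⟨_, hsrc k⟩
    · exact Or.inr ⟨_, hk, rfl⟩
  · intro k hk
    have := h.new k (Or.inr hk)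
    refine ⟨fun x => ?_, this.2⟩
    rcases hj.cover x with ⟨x, rfl⟩ | ⟨l, hl, rfl⟩
    · rw [hf₁]
      exact this.1 x
    · rw [hsrc]
      intro hlk
      rw [← t.emb_injective hlk] at hk
      exact d.notMem_B l hk

end PartialSub

end Iposet

/-! ### Alignment of words as subsumption of their iposets -/

namespace StepWord

open Iposet

variable {U V W W' : LoSet α}

/-- Aligned words have partially subsumed iposets. -/
theorem Align.exists_partialSub {w : StepWord α U W} {v : StepWord α V W'} {d : U ⟶ V}
    (h : Align w v d) : ∃ f, PartialSub w.src v.src d f := by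
  induction h with
  | nil U =>
    exact ⟨_root_.id, Function.injective_id, fun _ => rfl, fun _ _ h => h, fun _ _ h _ => h,
      fun _ => rfl, fun _ => Iff.rfl, fun y => Or.inl ⟨y, rfl⟩, fun k hk => hk.elim⟩
  | @startRight _ _ _ _ _ _ _ a ha v h ih =>
    obtain ⟨f, hf⟩ := ih
    obtain ⟨j, hj⟩ := startExt a ha v
    exact ⟨_, hf.startRight ha hj⟩
  | @endRight _ _ _ _ _ _ _ b hb v h ih =>
    obtain ⟨f, hf⟩ := ih
    obtain ⟨j, hj⟩ := endExt b hb v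
    exact ⟨_, hf.endRight hj⟩
  | @startLeft _ _ _ _ _ a ha w v d h ih =>
    obtain ⟨f, hf⟩ := ih
    obtain ⟨j, hj⟩ := startExt a ha w
    exact hf.startLeft hj ha
  | @endLeft _ _ _ _ _ b hb w v d h ih =>
    obtain ⟨f, hf⟩ := ih
    obtain ⟨j, hj⟩ := endExt b hb w
    exact hf.endLeft hb hj

/-- Words with partially subsumed iposets are aligned. -/
theorem align_of_partialSub (w : StepWord α U W) : ∀ {V W' : LoSet α} (v : StepWord α V W')
    (d : U ⟶ V) (f : w.iposet.carrier → v.iposet.carrier), PartialSub w.src v.src d f →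
    Align w v d := by
  induction w with
  | nil U =>
    intro V W' v
    induction v with
    | nil V =>
      intro d f h
      have hB : Coface.B d = ∅ := Set.eq_empty_of_forall_notMem fun k hk =>
        (h.new k hk).2 (Set.mem_univ _)
      have hA : Coface.A d = ∅ := by
        refine Set.eq_empty_of_forall_notMem fun k hk => ?_
        rcases h.cover k with ⟨x, hx⟩ | ⟨l, hl, hlk⟩
        · refine d.notMem_A x ?_
          have : f x = Coface.map d x := h.src x
          rwa [← this, hx]
        · rw [hB] at hl
          exact hl
      obtain ⟨rfl, rfl⟩ := Coface.eq_id_of_empty hA hB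
      exact .nil U
    | up a ha v ih =>
      intro d f h
      obtain ⟨j, hj⟩ := startExt a ha v
      obtain ⟨f₁, h₁⟩ := h.of_startRight ha hj
      exact .startRight a ha (ih _ _ h₁)
    | down b hb v ih =>
      intro d f h
      obtain ⟨j, hj⟩ := endExt b hb v
      -- All events of the exhausted word on the left lie in its target interface, so none
      -- corresponds to an event that `v` terminates.
      have hd : Coface.B b ⊆ Coface.B d := by
        intro k hk
        rcases h.cover ((down b hb v).src.emb k) with ⟨x, hx⟩ | ⟨l, hl, hlk⟩
        · exact ((hj.new k hk).2 (hx ▸ (h.tgt x).2 (Set.mem_univ x))).elim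
        · rwa [← Marking.emb_injective _ hlk]
      obtain ⟨d₁, f₁, rfl, h₁⟩ := h.of_endRight hb hj hd
      exact .endRight b hb (ih _ _ h₁)
  | up a ha w ihw =>
    intro V W' v
    obtain ⟨i, hi⟩ := startExt a ha w
    induction v with
    | nil V =>
      intro d f h
      obtain ⟨d₁, f₁, rfl, h₁⟩ := h.of_startLeft ha hi fun k => Set.mem_univ _
      exact .startLeft a ha (ihw _ _ _ h₁)
    | up a' ha' v ih =>
      intro d f h
      obtain ⟨j, hj⟩ := startExt a' ha' v
      obtain ⟨f₁, h₁⟩ := h.of_startRight ha' hj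
      exact .startRight a' ha' (ih _ _ h₁)
    | down b hb v ih =>
      intro d f h
      obtain ⟨j, hj⟩ := endExt b hb v
      -- The only real choice: the left word wants to start events and the right one to terminate
      -- some. If the former are already active on the right, the left word moves; otherwise the
      -- right one must.
      by_cases hS : ∀ k, f (i (w.src.emb k)) ∈ (down b hb v).iposet.S
      · obtain ⟨d₁, f₁, rfl, h₁⟩ := h.of_startLeft ha hi hS
        exact .startLeft a ha (ihw _ _ _ h₁)
      · push Not at hS
        obtain ⟨k, hk⟩ := hS
        -- If an event terminated by `b` were still present on the left, its image would precede
        -- that of the `k`-th active event, which is not yet started on the right. Subsumptions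
        -- reflect precedence, but the `k`-th event is minimal after the start on the left.
        have hd : Coface.B b ⊆ Coface.B d := by
          intro l hl
          rcases h.cover ((down b hb v).src.emb l) with ⟨x, hx⟩ | ⟨l', hl', hll⟩
          · exfalso
            obtain ⟨x, rfl⟩ := hi.bij.2 x
            have hp : (down b hb v).iposet.prec (f (i x)) (f (i (w.src.emb k))) := by
              rw [hx]
              rcases hj.cover (f (i (w.src.emb k))) with ⟨y, hy⟩ | ⟨l', -, hl'⟩
              · rw [← hy] at hk ⊢
                refine hj.prec_new l hl y fun hyS => hk ?_
                obtain ⟨m, rfl⟩ := v.src.exists_emb hyS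
                rw [← hj.src]
                exact Marking.emb_mem _ _
              · rw [← hl'] at hk
                exact (hk (Marking.emb_mem _ _)).elim
            exact w.iposet.S_minimal _ (w.src.emb_mem k) _ ((hi.prec _ _).1 (h.prec _ _ hp))
          · rwa [← Marking.emb_injective _ hll]
        obtain ⟨d₁, f₁, rfl, h₁⟩ := h.of_endRight hb hj hd
        exact .endRight b hb (ih _ _ h₁)
  | down b hb w ih =>
    intro V W' v d f h
    obtain ⟨j, hj⟩ := endExt b hb w
    exact .endLeft b hb (ih _ _ _ (h.of_endLeft hj))

end StepWord

/-! ### From partial subsumptions to subsumptions and isomorphisms -/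

namespace Iposet

variable {U V W : LoSet α} {P Q : Iposet α}

theorem PartialSub.subsumed {s : Marking U P P.S} {t : Marking U Q Q.S}
    {f : P.carrier → Q.carrier} (h : PartialSub s t (𝟙 U) f) : P.Subsumed Q := by
  have hsurj : Function.Surjective f := fun y =>
    (h.cover y).resolve_right fun ⟨k, hk, _⟩ => hk
  refine ⟨Equiv.ofBijective f ⟨h.inj, hsurj⟩, ?_, ?_, h.label, h.prec,
    fun x y h1 h2 h3 => h.event x y h1 ⟨h2, h3⟩⟩
  · ext y
    constructor
    · rintro ⟨x, hx, rfl⟩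
      obtain ⟨k, rfl⟩ := s.exists_emb hx
      change f (s.emb k) ∈ Q.S
      rw [h.src k]
      exact t.emb_mem _
    · intro hy
      obtain ⟨k, rfl⟩ := t.exists_emb hy
      exact ⟨s.emb k, s.emb_mem k, h.src k⟩
  · ext y
    constructor
    · rintro ⟨x, hx, rfl⟩
      exact (h.tgt x).2 hx
    · intro hy
      obtain ⟨x, rfl⟩ := hsurj y
      exact ⟨x, (h.tgt x).1 hy, rfl⟩

/-- Lo-sets that mark isomorphic interfaces are equal, and the markings are related by the
isomorphism. -/
theorem Marking.eq_of_iso {I : Set P.carrier} {J : Set Q.carrier} (s : Marking U P I)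
    (t : Marking V Q J) (f : I ≃ J)
    (hf : ∀ x y : I, P.event x y → Q.event (f x) (f y)) (hl : ∀ x : I, Q.label (f x) = P.label x) :
    ∃ h : U = V, ∀ k, (f (s.equiv k) : Q.carrier) = t.emb (Fin.cast (congrArg LoSet.size h) k) := by
  let g := (s.equiv.trans f).trans t.equiv.symm
  have hg : ∀ k, t.equiv (g k) = f (s.equiv k) := fun k => by simp [g]
  have hlt : ∀ {i j}, i < j → g i < g j := fun {i j} hij => by
    rw [t.event_iff, hg, hg]
    exact hf _ _ ((s.event_iff i j).1 hij)
  let c : U ⟶ V := Coface.ofMap g (fun _ _ => hlt)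
    (fun i => by rw [← t.label_eq, hg, hl, s.label_eq]) ∅ (fun _ => Set.notMem_empty _)
  have hA : Coface.A c = ∅ := by
    change (Set.range g)ᶜ \ ∅ = ∅
    rw [g.surjective.range_eq]
    simp
  obtain ⟨h, hc⟩ := Coface.eq_id_of_empty (c := c) hA rfl
  refine ⟨h, fun k => ?_⟩
  subst h
  have : g k = k := by
    change Coface.map c k = k
    rw [hc]
    rfl
  rw [← hg, this]
  rfl

/-- Source interfaces contain only concurrent events, so a subsumption restricts to an isomorphism
between them; as words, the marking lo-sets are therefore equal. -/
theorem Subsumed.exists_partialSub (h : P.Subsumed Q) (s : Marking U P P.S)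
    (t : Marking V Q Q.S) : ∃ e : U = V, ∃ f, PartialSub s t (eqToHom e) f := by
  obtain ⟨f, hf⟩ := h
  have hS : ∀ x, f x ∈ Q.S ↔ x ∈ P.S := fun x => by rw [← hf.src]; exact f.injective.mem_set_image
  have hT : ∀ x, f x ∈ Q.T ↔ x ∈ P.T := fun x => by rw [← hf.tgt]; exact f.injective.mem_set_image
  obtain ⟨rfl, hst⟩ := s.eq_of_iso t (f.subtypeEquiv fun x => (hS x).symm)
    (fun x y hxy => hf.event _ _ hxy (P.conc_of_S x.2 y.2).1 (P.conc_of_S x.2 y.2).2)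
    fun x => hf.label x
  exact ⟨rfl, f, f.injective, hf.label, hf.prec, fun x y h hc => hf.event x y h hc.1 hc.2,
    hst, hT, fun y => Or.inl (f.surjective y), fun k hk => hk.elim⟩

/-- The composite of the two subsumptions is a permutation of a finite set that reflects precedence.
Counting the related pairs shows that it also preserves precedence, and then so does the first
subsumption because the second reflects it. -/
theorem Subsumed.isomorphic (h : P.Subsumed Q) (h' : Q.Subsumed P) : P.Isomorphic Q := by
  obtain ⟨f, hf⟩ := h
  obtain ⟨g, hg⟩ := h'
  refine ⟨f, hf, ?_⟩
  have := P.finite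
  let r : P.carrier × P.carrier → P.carrier × P.carrier := Prod.map (f.trans g) (f.trans g)
  let A : Set (P.carrier × P.carrier) := {x | P.prec x.1 x.2}
  have hr : Function.Injective r := (f.trans g).injective.prodMap (f.trans g).injective
  have hsub : r ⁻¹' A ⊆ A := fun x hx => hf.prec _ _ (hg.prec _ _ hx)
  have hcard : (r ⁻¹' A).ncard = A.ncard := by
    refine Set.ncard_preimage_of_injective_subset_range hr ?_
    rw [(Finite.surjective_of_injective hr).range_eq]
    exact Set.subset_univ _
  have heq : r ⁻¹' A = A := Set.eq_of_subset_of_ncard_le hsub hcard.ge (Set.toFinite _)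
  intro x y hxy
  have : (x, y) ∈ r ⁻¹' A := by rw [heq]; exact hxy
  exact hg.prec _ _ this

end Iposet

/-- Subsumption of the iposets of words is alignment of the words. -/
theorem StepWord.subsumed_iff_align {U V W W' : LoSet α} (w : StepWord α U W)
    (v : StepWord α V W') :
    w.iposet.Subsumed v.iposet ↔ ∃ e : U = V, StepWord.Align w v (eqToHom e) := by
  constructor
  · intro h
    obtain ⟨e, f, hf⟩ := h.exists_partialSub w.src v.src
    exact ⟨e, align_of_partialSub w v _ f hf⟩
  · rintro ⟨rfl, h⟩
    obtain ⟨f, hf⟩ := h.exists_partialSub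
    exact hf.subsumed

/-! ### Iposets of step words are interval -/

namespace StepWord

open Iposet

variable {U V W : LoSet α}

/-- Left endpoints are kept positive to leave room on the left. For a terminating step the
representation is shifted by one, source events begin at 1, and terminated events are the point 1,
before every event that is not yet started. -/
theorem exists_interval_representation (w : StepWord α U W) :
    ∃ b e : w.iposet.carrier → ℝ, (∀ x, 0 < b x ∧ b x ≤ e x) ∧
      ∀ x y, w.iposet.prec x y ↔ e x < b y := by
  induction w with
  | nil U => exact ⟨fun _ => 1, fun _ => 1, by simp, fun x y => iff_of_false (fun h => h) (by simp)⟩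
  | up a ha w ih =>
    obtain ⟨b, e, hbe, h⟩ := ih
    obtain ⟨j, hj⟩ := startExt a ha w
    choose g hg using hj.bij.2
    refine ⟨b ∘ g, e ∘ g, fun x => hbe _, fun x y => ?_⟩
    rw [Function.comp_apply, Function.comp_apply, ← h, ← hj.prec, hg, hg]
  | down c hc w ih =>
    obtain ⟨b, e, hbe, h⟩ := ih
    obtain ⟨j, hj⟩ := endExt c hc w
    have hS : ∀ x, j x ∉ (down c hc w).iposet.S → x ∉ w.iposet.S := by
      intro x hx hxS
      obtain ⟨k, rfl⟩ := w.src.exists_emb hxS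
      exact hx (hj.src k ▸ Marking.emb_mem _ _)
    have hb : ∀ r, ∃ y : ℝ, (r ∈ (down c hc w).iposet.S → y = 1) ∧
        ∀ x, r ∉ (down c hc w).iposet.S → j x = r → y = b x + 1 := by
      intro r
      by_cases hr : r ∈ (down c hc w).iposet.S
      · exact ⟨1, fun _ => rfl, fun x h => (h hr).elim⟩
      · rcases hj.cover r with ⟨x, rfl⟩ | ⟨k, -, rfl⟩
        · exact ⟨b x + 1, fun h => (hr h).elim, fun y _ hy => by rw [hj.inj hy]⟩
        · exact (hr (Marking.emb_mem _ _)).elim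
    have he : ∀ r, ∃ y : ℝ, (∀ k ∈ Coface.B c, (down c hc w).src.emb k = r → y = 1) ∧
        ∀ x, j x = r → y = e x + 1 := by
      intro r
      rcases hj.cover r with ⟨x, rfl⟩ | ⟨k, hk, rfl⟩
      · exact ⟨e x + 1, fun k hk hkx => ((hj.new k hk).1 x hkx.symm).elim,
          fun y hy => by rw [hj.inj hy]⟩
      · exact ⟨1, fun _ _ _ => rfl, fun x hx => ((hj.new k hk).1 x hx).elim⟩
    choose b' hb₁ hb₂ using hb
    choose e' he₁ he₂ using he
    have he0 : ∀ r, 1 ≤ e' r := by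
      intro r
      rcases hj.cover r with ⟨x, rfl⟩ | ⟨k, hk, rfl⟩
      · have := hbe x
        rw [he₂ _ x rfl]
        linarith
      · rw [he₁ _ k hk rfl]
    refine ⟨b', e', fun r => ?_, fun r r' => ?_⟩
    · by_cases hr : r ∈ (down c hc w).iposet.S
      · rw [hb₁ r hr]
        exact ⟨one_pos, he0 r⟩
      · rcases hj.cover r with ⟨x, rfl⟩ | ⟨k, -, rfl⟩
        · have := hbe x
          rw [hb₂ _ x hr rfl, he₂ _ x rfl]
          exact ⟨by linarith, by linarith⟩
        · exact (hr (Marking.emb_mem _ _)).elim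
    · by_cases hr : r' ∈ (down c hc w).iposet.S
      · refine iff_of_false (Iposet.S_minimal _ _ hr _) ?_
        rw [hb₁ _ hr]
        exact (he0 r).not_gt
      · rcases hj.cover r' with ⟨y, rfl⟩ | ⟨k, -, rfl⟩
        · rw [hb₂ _ y hr rfl]
          rcases hj.cover r with ⟨x, rfl⟩ | ⟨k, hk, rfl⟩
          · rw [he₂ _ x rfl, hj.prec, h, add_lt_add_iff_right]
          · rw [he₁ _ k hk rfl]
            refine iff_of_true (hj.prec_new k hk y (hS y hr)) ?_
            linarith [(hbe y).1]
        · exact (hr (Marking.emb_mem _ _)).elim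

theorem isInterval (w : StepWord α U W) : w.iposet.IsInterval := by
  obtain ⟨b, e, h, h'⟩ := w.exists_interval_representation
  exact ⟨b, e, fun x => (h x).2, h'⟩

end StepWord

/-! ### Interval iposets come from step words -/

namespace Iposet

variable {U V : LoSet α}

-- Source events are pairwise concurrent, so the event order is total on them and they can be
-- enumerated by `Fin`.
open Classical in
theorem exists_marking (P : Iposet α) : ∃ U : LoSet α, Nonempty (Marking U P P.S) := by
  have := P.finite
  have : Fintype P.S := Fintype.ofFinite _
  let r : P.S → P.S → Prop := fun x y => P.event x y
  have : IsStrictTotalOrder P.S r :=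
    { trichotomous := fun x y h h' => by
        rcases P.event_trichotomy (P.conc_of_S x.2 y.2) with e | e | e
        · exact Subtype.ext e
        · exact (h e).elim
        · exact (h' e).elim
      irrefl := fun x => P.event_irrefl _
      trans := fun x y z => P.event_trans _ _ _ }
  let : LinearOrder P.S := linearOrderOfSTO r
  let e : Fin (Fintype.card P.S) ≃o P.S := Fintype.orderIsoFinOfCardEq P.S rfl
  exact ⟨⟨Fintype.card P.S, fun i => P.label (e i)⟩, ⟨⟨e.toEquiv, fun i j => e.lt_iff_lt.symm,
    fun _ => rfl⟩⟩⟩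

/-- An iposet is realized by step words if it agrees with the iposet of some step word. -/
def IsRealized {P : Iposet α} (s : Marking U P P.S) : Prop :=
  ∃ (W : LoSet α) (w : StepWord α U W), (∃ f, PartialSub s w.src (𝟙 U) f) ∧
    ∃ f, PartialSub w.src s (𝟙 U) f

/-- Both partial subsumptions are extended by the same start: `startLeft` performs it on one side
and `startRight` on the other. -/
theorem IsRealized.start {P Q : Iposet α} {s : Marking U P P.S} {t : Marking V Q Q.S} {a : U ⟶ V}
    (ha : Coface.B a = ∅) {j : Q.carrier → P.carrier} (hj : StartExt s t a j)
    (h : IsRealized t) : IsRealized s := by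
  obtain ⟨W, w, ⟨f, hf⟩, ⟨g, hg⟩⟩ := h
  obtain ⟨i, hi⟩ := StepWord.startExt a ha w
  obtain ⟨f', hf'⟩ := hf.startLeft hj ha
  obtain ⟨g', hg'⟩ := hg.startLeft hi ha
  exact ⟨W, .up a ha w,
    ⟨_, PartialSub.startRight (d := 𝟙 U) ha hi (by simpa using hf')⟩,
    ⟨_, PartialSub.startRight (d := 𝟙 U) ha hj (by simpa using hg')⟩⟩

theorem IsRealized.finish {P Q : Iposet α} {s : Marking U P P.S} {t : Marking V Q Q.S} {b : V ⟶ U}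
    (hb : Coface.A b = ∅) {j : Q.carrier → P.carrier} (hj : EndExt s t b j)
    (h : IsRealized t) : IsRealized s := by
  obtain ⟨W, w, ⟨f, hf⟩, ⟨g, hg⟩⟩ := h
  obtain ⟨i, hi⟩ := StepWord.endExt b hb w
  have hf' := hf.endRight hi
  have hg' := hg.endRight hj
  exact ⟨W, .down b hb w, PartialSub.endLeft (d := 𝟙 U) hb hj (by simpa using hf'),
    PartialSub.endLeft (d := 𝟙 U) hb hi (by simpa using hg')⟩

theorem isRealized_of_univ {P : Iposet α} (s : Marking U P P.S) (hS : ∀ x, x ∈ P.S)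
    (hT : ∀ x, x ∈ P.T) : IsRealized s := by
  choose g hg using fun x => s.exists_emb (hS x)
  have hg' : ∀ k, g (s.emb k) = k := fun k => s.emb_injective (hg _)
  refine ⟨U, .nil U, ⟨g, ?_, ?_, ?_, ?_, ?_, ?_, ?_, ?_⟩, ⟨s.emb, ?_, ?_, ?_, ?_, ?_, ?_, ?_, ?_⟩⟩
  · exact fun x y h => by rw [← hg x, ← hg y, h]
  · exact fun x => (s.emb_label (g x)).symm.trans (congrArg P.label (hg x))
  · exact fun x y h => h.elim
  · intro x y h _
    rw [← hg x, ← hg y, s.emb_event] at h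
    exact h
  · exact hg'
  · exact fun x => iff_of_true (Set.mem_univ _) (hT x)
  · exact fun y => Or.inl ⟨_, hg' y⟩
  · exact fun k hk => hk.elim
  · exact s.emb_injective
  · exact s.emb_label
  · exact fun x y h => (P.S_minimal _ (hS _) _ h).elim
  · exact fun x y h _ => s.emb_event.2 h
  · exact fun _ => rfl
  · exact fun x => iff_of_true (hT _) (Set.mem_univ _)
  · exact fun y => Or.inl ⟨_, hg y⟩
  · exact fun k hk => hk.elim

/-- Enlarging the source interface by a minimal element. -/
def insertS (P : Iposet α) (x : P.carrier) (hx : ∀ y, ¬ P.prec y x) : Iposet α :=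
  { P with
    S := insert x P.S
    S_minimal := by
      rintro y (rfl | hy)
      · exact hx
      · exact P.S_minimal y hy }

theorem exists_startExt_insertS {P : Iposet α} (s : Marking U P P.S) (x : P.carrier)
    (hx : ∀ y, ¬ P.prec y x) (t : Marking V (P.insertS x hx) (P.insertS x hx).S) :
    ∃ a : U ⟶ V, Coface.B a = ∅ ∧ StartExt s t a _root_.id := by
  have hmem : ∀ k, s.emb k ∈ (P.insertS x hx).S := fun k => Or.inr (s.emb_mem k)
  choose g hg using fun k => t.exists_emb (hmem k)
  let a : U ⟶ V := Coface.ofMap g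
    (fun i j hij => by rw [← t.emb_event, hg, hg]; exact s.emb_event.2 hij)
    (fun i => by rw [← t.emb_label, hg]; exact s.emb_label i) ∅ (fun i => Set.notMem_empty _)
  exact ⟨a, rfl, Function.bijective_id, fun _ => rfl, fun _ _ => Iff.rfl, fun _ _ h _ => h,
    fun k => (hg k).symm, fun _ => Iff.rfl⟩

/-- Removing an element. -/
def erase (P : Iposet α) (x : P.carrier) : Iposet α where
  carrier := {y : P.carrier // y ≠ x}
  finite := have := P.finite; inferInstance
  prec y z := P.prec y z
  event y z := P.event y z
  S := {y | y.1 ∈ P.S}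
  T := {y | y.1 ∈ P.T}
  label y := P.label y
  prec_irrefl _ := P.prec_irrefl _
  prec_trans _ _ _ := P.prec_trans _ _ _
  event_irrefl _ := P.event_irrefl _
  event_trans _ _ _ := P.event_trans _ _ _
  comparable y z := by
    rw [Subtype.ext_iff]
    exact P.comparable _ _
  S_minimal _ h _ := P.S_minimal _ h _
  T_maximal _ h _ := P.T_maximal _ h _

theorem exists_endExt_erase {P : Iposet α} (s : Marking U P P.S) (x : P.carrier)
    (hxS : x ∈ P.S) (hxT : x ∉ P.T) (hx : ∀ y ∉ P.S, P.prec x y)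
    (t : Marking V (P.erase x) (P.erase x).S) :
    ∃ b : V ⟶ U, Coface.A b = ∅ ∧ EndExt s t b Subtype.val := by
  have hmem : ∀ k, (t.emb k).1 ∈ P.S := fun k => t.emb_mem k
  choose g hg using fun k => s.exists_emb (hmem k)
  let b : V ⟶ U := Coface.ofMap g
    (fun i j hij => by rw [← s.emb_event, hg, hg]; exact t.emb_event.2 hij)
    (fun i => by rw [← s.emb_label, hg]; exact t.emb_label i) (Set.range g)ᶜ (fun i h => h ⟨i, rfl⟩)
  -- The image of the remaining source events omits only the erased element.
  have hB : ∀ k, k ∈ Coface.B b → s.emb k = x := by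
    intro k hk
    by_contra hne
    obtain ⟨l, hl⟩ := t.exists_emb (x := ⟨s.emb k, hne⟩) (s.emb_mem k)
    refine hk ⟨l, s.emb_injective ?_⟩
    rw [hg, hl]
  refine ⟨b, Set.sdiff_self, Subtype.val_injective, fun _ => rfl, fun _ _ => Iff.rfl,
    fun _ _ h _ => h, hg, fun _ => Iff.rfl, fun r => ?_, fun k hk => ⟨fun y => ?_, ?_⟩,
    fun k hk y hy => ?_⟩
  · by_cases hr : r = x
    · obtain ⟨k, rfl⟩ := s.exists_emb hxS
      refine Or.inr ⟨k, ?_, hr.symm⟩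
      rintro ⟨l, rfl⟩
      exact (t.emb l).2 (hg l).symm
    · exact Or.inl ⟨⟨r, hr⟩, rfl⟩
  · rw [hB k hk]
    exact y.2
  · rwa [hB k hk]
  · rw [hB k hk]
    exact hx y.1 hy

/-- The three cases are: nothing to do, a possible first start, a possible first termination. If
events remain to be started, take `x` with leftmost beginning. If some `y` precedes `x`, then `y`
ends before `x` begins, hence `y` is a source event and precedes everything outside the interface,
so it can be terminated; otherwise `x` can be started. -/
theorem IsInterval.cases {P : Iposet α} (h : P.IsInterval) :
    (∀ x, x ∈ P.S ∧ x ∈ P.T) ∨ (∃ x ∉ P.S, ∀ y, ¬ P.prec y x) ∨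
      ∃ x ∈ P.S, x ∉ P.T ∧ ∀ y ∉ P.S, P.prec x y := by
  have := P.finite
  obtain ⟨b, e, hbe, hp⟩ := h
  by_cases hS : ∀ x, x ∈ P.S
  · by_cases hT : ∀ x, x ∈ P.T
    · exact Or.inl fun x => ⟨hS x, hT x⟩
    · push Not at hT
      obtain ⟨x, hx⟩ := hT
      exact Or.inr (Or.inr ⟨x, hS x, hx, fun y hy => (hy (hS y)).elim⟩)
  · push Not at hS
    obtain ⟨x, hx, hmin⟩ := Set.exists_min_image P.Sᶜ b (Set.toFinite _) hS
    by_cases hxm : ∀ y, ¬ P.prec y x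
    · exact Or.inr (Or.inl ⟨x, hx, hxm⟩)
    · push Not at hxm
      obtain ⟨y, hy⟩ := hxm
      have hyx := (hp y x).1 hy
      refine Or.inr (Or.inr ⟨y, ?_, fun hT => P.T_maximal y hT _ hy, fun z hz =>
        (hp y z).2 (hyx.trans_le (hmin z hz))⟩)
      by_contra hyS
      linarith [hmin y hyS, hbe y]

/-- Every interval iposet is the iposet of a step word. -/
theorem IsInterval.isRealized (n : ℕ) : ∀ {U : LoSet α} {P : Iposet α} (s : Marking U P P.S),
    P.IsInterval → Nat.card P.carrier + P.Sᶜ.ncard ≤ n → IsRealized s := by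
  -- Undoing a start moves an element into the source interface without changing the carrier;
  -- undoing a termination removes an element. Either lowers the measure.
  induction n with
  | zero =>
    intro U P s _ hn
    have := P.finite
    have : IsEmpty P.carrier := by
      rw [← Finite.card_eq_zero_iff]
      omega
    exact isRealized_of_univ s isEmptyElim isEmptyElim
  | succ n ih =>
    intro U P s h hn
    have := P.finite
    rcases h.cases with h' | ⟨x, hx, hxm⟩ | ⟨x, hxS, hxT, hxp⟩
    · exact isRealized_of_univ s (fun x => (h' x).1) fun x => (h' x).2
    · obtain ⟨V, ⟨t⟩⟩ := (P.insertS x hxm).exists_marking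
      obtain ⟨a, ha, hj⟩ := exists_startExt_insertS s x hxm t
      refine IsRealized.start ha hj (ih t h ?_)
      have : Finite (P.insertS x hxm).carrier := P.finite
      have : (P.insertS x hxm).Sᶜ.ncard < P.Sᶜ.ncard := by
        refine Set.ncard_lt_ncard ⟨fun y hy hyS => hy (Or.inr hyS), fun hsub => ?_⟩
          (Set.toFinite _)
        exact hsub hx (Or.inl rfl)
      have h2 : Nat.card (P.insertS x hxm).carrier = Nat.card P.carrier := rfl
      omega
    · obtain ⟨V, ⟨t⟩⟩ := (P.erase x).exists_marking
      obtain ⟨b, hb, hj⟩ := exists_endExt_erase s x hxS hxT hxp t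
      refine IsRealized.finish hb hj (ih t ?_ ?_)
      · obtain ⟨b, e, hbe, hp⟩ := h
        exact ⟨fun y => b y.1, fun y => e y.1, fun y => hbe _, fun y z => hp _ _⟩
      · have h1 : Nat.card (P.erase x).carrier < Nat.card P.carrier :=
          Finite.card_subtype_lt (p := fun y => y ≠ x) (x := x) (by simp)
        have h2 : (P.erase x).Sᶜ.ncard ≤ P.Sᶜ.ncard :=
          Set.ncard_le_ncard_of_injOn Subtype.val (fun y hy => hy) Subtype.val_injective.injOn
            (Set.toFinite _)
        omega

theorem IsInterval.exists_stepWord {P : Iposet α} (h : P.IsInterval) :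
    ∃ (U W : LoSet α) (w : StepWord α U W), P.Isomorphic w.iposet := by
  obtain ⟨U, ⟨s⟩⟩ := P.exists_marking
  obtain ⟨W, w, ⟨f, hf⟩, ⟨g, hg⟩⟩ := IsInterval.isRealized _ s h le_rfl
  exact ⟨U, W, w, hf.subsumed.isomorphic hg.subsumed⟩

end Iposet

/-! ### Associativity and monotonicity of gluing -/

namespace Iposet

variable {U V V' : LoSet α} {P Q R P₀ Q₀ : Iposet α}

theorem glue_not_prec_inR_inl (f : Matching P Q) {x : Q.carrier} {y : P.carrier} (hx : x ∉ Q.S)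
    (hy : y ∉ P.T) : ¬ (P.glue Q f).prec (f.inR x) (Sum.inl y) := by
  rintro (⟨a, b, h, e, e'⟩ | ⟨a, b, h, e, e'⟩ | ⟨a, b, ha, hb, e, e'⟩)
  · exact hx (f.inR_eq_inl e.symm).2
  · exact hy (f.inR_eq_inl e').1
  · exact hy (f.inR_eq_inl e').1

/-- The target interface of a gluing is that of its second factor. -/
noncomputable def Marking.glueRight (t : Marking U Q Q.T) (f : Matching P Q) :
    Marking U (P.glue Q f) (P.glue Q f).T :=
  .ofEmb (fun k => f.inR (t.emb k))
    (fun x => by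
      constructor
      · rintro ⟨y, hy, rfl⟩
        obtain ⟨k, rfl⟩ := t.exists_emb hy
        exact ⟨k, rfl⟩
      · rintro ⟨k, rfl⟩
        exact ⟨_, t.emb_mem k, rfl⟩)
    (fun i j => by
      refine ⟨fun h => glue_event_inR f (t.emb_event.2 h), fun h => ?_⟩
      refine t.emb_event.1 (event_of_event_map (Q := P.glue Q f) (f := f.inR)
        (fun _ _ h _ => glue_event_inR f h) (Q.conc_of_T (t.emb_mem i) (t.emb_mem j)) h))
    (fun i => by rw [glue_label_inR, t.emb_label])

theorem Marking.glueRight_emb (t : Marking U Q Q.T) (f : Matching P Q) (k : Fin U.size) :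
    (t.glueRight f).emb k = f.inR (t.emb k) := rfl

/-- `R` is the gluing of `P` and `Q` along the markings `p`, `q`, with structural maps `i`, `j`. -/
structure IsGluing (p : Marking V P P.T) (q : Marking V Q Q.S) (i : P.carrier → R.carrier)
    (j : Q.carrier → R.carrier) : Prop where
  left_inj : Function.Injective i
  right_inj : Function.Injective j
  glue : ∀ k, i (p.emb k) = j (q.emb k)
  inter : ∀ x y, i x = j y → x ∈ P.T
  cover : ∀ r, (∃ x, i x = r) ∨ ∃ y, j y = r
  left_label : ∀ x, R.label (i x) = P.label x
  right_label : ∀ y, R.label (j y) = Q.label y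
  left_prec : ∀ x y, R.prec (i x) (i y) ↔ P.prec x y
  right_prec : ∀ x y, R.prec (j x) (j y) ↔ Q.prec x y
  prec : ∀ x y, x ∉ P.T → y ∉ Q.S → R.prec (i x) (j y)
  not_prec : ∀ x y, x ∉ P.T → y ∉ Q.S → ¬ R.prec (j y) (i x)
  left_event : ∀ x y, P.event x y → R.event (i x) (i y)
  right_event : ∀ x y, Q.event x y → R.event (j x) (j y)
  src : i '' P.S = R.S
  tgt : j '' Q.T = R.T

namespace IsGluing

variable {p : Marking V P P.T} {q : Marking V Q Q.S} {i : P.carrier → R.carrier}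
  {j : Q.carrier → R.carrier}

theorem mem_S_of_eq (h : IsGluing p q i j) {x : P.carrier} {y : Q.carrier} (hxy : i x = j y) :
    y ∈ Q.S := by
  obtain ⟨k, rfl⟩ := p.exists_emb (h.inter x y hxy)
  rw [h.glue] at hxy
  exact h.right_inj hxy ▸ q.emb_mem k

/-- A discrete first factor is neutral. -/
theorem nil (q : Marking V Q Q.S) :
    IsGluing (Marking.univ V Set.univ Set.univ) q (R := Q) q.emb _root_.id where
  left_inj := q.emb_injective
  right_inj := Function.injective_id
  glue _ := rfl
  inter _ _ _ := Set.mem_univ _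
  cover r := Or.inr ⟨r, rfl⟩
  left_label := q.emb_label
  right_label _ := rfl
  left_prec x y := iff_of_false (Q.S_minimal _ (q.emb_mem y) _) fun h => h
  right_prec _ _ := Iff.rfl
  prec x _ hx := (hx (Set.mem_univ x)).elim
  not_prec x _ hx := (hx (Set.mem_univ x)).elim
  left_event x y h := q.emb_event.2 h
  right_event _ _ h := h
  src := by
    ext x
    constructor
    · rintro ⟨k, -, rfl⟩
      exact q.emb_mem k
    · intro hx
      obtain ⟨k, rfl⟩ := q.exists_emb hx
      exact ⟨k, Set.mem_univ k, rfl⟩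
  tgt := Set.image_id _

/-- Associativity: gluing `P₀` in front of a gluing. -/
theorem glue_left (h : IsGluing p q i j) (t : Marking U P₀ P₀.T) (s : Marking U P P.S)
    (s' : Marking U R R.S) (hs : ∀ k, i (s.emb k) = s'.emb k) :
    ∃ i', IsGluing (R := P₀.glue R (t.matching s')) (p.glueRight (t.matching s)) q i'
      ((t.matching s').inR ∘ j) ∧ ∀ x, i' (Sum.inl x) = Sum.inl x := by
  set g := t.matching s with hg
  set g' := t.matching s' with hg'
  let i' : (P₀.glue P g).carrier → (P₀.glue R g').carrier :=
    Sum.elim Sum.inl fun x => g'.inR (i x)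
  have hi : ∀ x, i' (g.inR x) = g'.inR (i x) := by
    intro x
    by_cases hx : x ∈ P.S
    · obtain ⟨k, rfl⟩ := s.exists_emb hx
      rw [hs, hg, hg', Marking.inR_matching, Marking.inR_matching]
      rfl
    · rw [g.inR_of_notMem hx]
      rfl
  have hinl : ∀ x, i' (Sum.inl x) = Sum.inl x := fun _ => rfl
  have hS : ∀ {x}, i x ∈ R.S ↔ x ∈ P.S := by
    intro x
    rw [← h.src]
    exact h.left_inj.mem_set_image
  have hjS : ∀ {y}, y ∉ Q.S → j y ∉ R.S := by
    intro y hy hyR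
    rw [← h.src] at hyR
    obtain ⟨x, -, hx⟩ := hyR
    exact hy (h.mem_S_of_eq hx)
  have hT : ∀ {x}, g.inR x ∈ (P₀.glue P g).T ↔ x ∈ P.T := glue_tgt_inR g _
  have hc : ∀ r : (P₀.glue P g).carrier, (∃ x, g.inR x = r) ∨
    ∃ x, x ∉ P₀.T ∧ Sum.inl x = r := glue_cover g
  have hprec : ∀ x y, (P₀.glue R g').prec (i' x) (i' y) ↔ (P₀.glue P g).prec x y := by
    have hRR : ∀ x y, (P₀.glue R g').prec (i' (g.inR x)) (i' (g.inR y)) ↔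
        (P₀.glue P g).prec (g.inR x) (g.inR y) := fun x y => by
      rw [hi, hi, glue_prec_inR, glue_prec_inR, h.left_prec]
    have hLL : ∀ x y, (P₀.glue R g').prec (i' (Sum.inl x)) (i' (Sum.inl y)) ↔
        (P₀.glue P g).prec (Sum.inl x) (Sum.inl y) := fun x y => by
      rw [hinl, hinl, glue_prec_inl, glue_prec_inl]
    intro x y
    rcases hc x with ⟨x, rfl⟩ | ⟨x, hx, rfl⟩ <;> rcases hc y with ⟨y, rfl⟩ | ⟨y, hy, rfl⟩
    · exact hRR x y
    · by_cases hxS : x ∈ P.S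
      · obtain ⟨k, rfl⟩ := s.exists_emb hxS
        rw [hg, Marking.inR_matching]
        exact hLL _ _
      · rw [hi]
        exact iff_of_false (glue_not_prec_inR_inl g' (mt hS.1 hxS) hy)
          (glue_not_prec_inR_inl g hxS hy)
    · by_cases hyS : y ∈ P.S
      · obtain ⟨k, rfl⟩ := s.exists_emb hyS
        rw [hg, Marking.inR_matching]
        exact hLL _ _
      · rw [hi]
        exact iff_of_true (glue_prec_inl_inR g' hx (mt hS.1 hyS)) (glue_prec_inl_inR g hx hyS)
    · exact hLL x y
  refine ⟨i', ⟨?_, g'.inR_injective.comp h.right_inj, ?_, ?_, ?_, ?_, ?_, hprec, ?_, ?_, ?_, ?_, ?_,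
    ?_, ?_⟩, hinl⟩
  · intro x y hxy
    rcases hc x with ⟨x, rfl⟩ | ⟨x, hx, rfl⟩ <;> rcases hc y with ⟨y, rfl⟩ | ⟨y, hy, rfl⟩
    · rw [hi, hi] at hxy
      rw [h.left_inj (g'.inR_injective hxy)]
    · rw [hi] at hxy
      exact (hy (g'.inR_eq_inl hxy).1).elim
    · rw [hi] at hxy
      exact (hx (g'.inR_eq_inl hxy.symm).1).elim
    · exact congrArg Sum.inl (Sum.inl_injective hxy)
  · intro k
    rw [Marking.glueRight_emb, hi, h.glue]
    rfl
  · intro x y hxy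
    rcases hc x with ⟨x, rfl⟩ | ⟨x, hx, rfl⟩
    · rw [hi] at hxy
      exact hT.2 (h.inter x y (g'.inR_injective hxy))
    · exact (hx (g'.inR_eq_inl hxy.symm).1).elim
  · intro r
    rcases glue_cover g' r with ⟨r, rfl⟩ | ⟨x, -, rfl⟩
    · rcases h.cover r with ⟨x, rfl⟩ | ⟨y, rfl⟩
      · exact Or.inl ⟨_, hi x⟩
      · exact Or.inr ⟨y, rfl⟩
    · exact Or.inl ⟨_, hinl x⟩
  · intro x
    rcases hc x with ⟨x, rfl⟩ | ⟨x, hx, rfl⟩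
    · rw [hi, glue_label_inR, glue_label_inR, h.left_label]
    · rfl
  · intro y
    exact (glue_label_inR g' (j y)).trans (h.right_label y)
  · intro x y
    exact (glue_prec_inR g' _ _).trans (h.right_prec x y)
  · intro x y hx hy
    rcases hc x with ⟨x, rfl⟩ | ⟨x, hx', rfl⟩
    · rw [hi]
      exact (glue_prec_inR g' _ _).2 (h.prec x y (mt hT.2 hx) hy)
    · exact glue_prec_inl_inR g' hx' (hjS hy)
  · intro x y hx hy
    rcases hc x with ⟨x, rfl⟩ | ⟨x, hx', rfl⟩
    · rw [hi]
      exact mt (glue_prec_inR g' _ _).1 (h.not_prec x y (mt hT.2 hx) hy)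
    · exact glue_not_prec_inR_inl g' (hjS hy) hx'
  · intro x y hxy
    refine Relation.TransGen.lift i' (fun a b hab => ?_) _ _ hxy
    rcases hab with ⟨a, b, hab, rfl, rfl⟩ | ⟨a, b, hab, rfl, rfl⟩
    · exact Or.inl ⟨a, b, hab, rfl, rfl⟩
    · exact Or.inr ⟨_, _, h.left_event _ _ hab, (hi a).symm, (hi b).symm⟩
  · intro x y hxy
    exact glue_event_inR g' (h.right_event x y hxy)
  · exact Set.image_image i' Sum.inl P₀.S
  · change _ '' _ = g'.inR '' R.T
    rw [← h.tgt, Set.image_image]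
    rfl

/-- Monotonicity of gluing. -/
theorem exists_subsumption (h : IsGluing p q i j) {φ : P₀.carrier ≃ P.carrier}
    {ψ : Q₀.carrier ≃ Q.carrier} (hφ : IsSubsumption P₀ P φ) (hψ : IsSubsumption Q₀ Q ψ)
    (f : Matching P₀ Q₀) (hf : ∀ t : P₀.T, i (φ t) = j (ψ (f.equiv t))) :
    ∃ e, IsSubsumption (P₀.glue Q₀ f) R e ∧ (∀ x, e (Sum.inl x) = i (φ x)) ∧
      ∀ y, e (f.inR y) = j (ψ y) := by
  let e : (P₀.glue Q₀ f).carrier → R.carrier := Sum.elim (fun x => i (φ x)) fun y => j (ψ y)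
  have heL : ∀ x, e (Sum.inl x) = i (φ x) := fun _ => rfl
  have heR : ∀ y, e (f.inR y) = j (ψ y) := by
    intro y
    rcases f.inR_cases y with ⟨hy, e'⟩ | ⟨t, rfl, e'⟩
    · rw [e']
      rfl
    · rw [e', heL, hf]
  have hφT : ∀ {x}, φ x ∈ P.T ↔ x ∈ P₀.T := by
    intro x
    rw [← hφ.tgt]
    exact φ.injective.mem_set_image
  have hψS : ∀ {y}, ψ y ∈ Q.S ↔ y ∈ Q₀.S := by
    intro x
    rw [← hψ.src]
    exact ψ.injective.mem_set_image
  have hc : ∀ r : (P₀.glue Q₀ f).carrier, (∃ y, f.inR y = r) ∨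
    ∃ x, x ∉ P₀.T ∧ Sum.inl x = r := glue_cover f
  have hinj : Function.Injective e := by
    intro x y hxy
    rcases hc x with ⟨x, rfl⟩ | ⟨x, hx, rfl⟩ <;> rcases hc y with ⟨y, rfl⟩ | ⟨y, hy, rfl⟩
    · rw [heR, heR] at hxy
      rw [ψ.injective (h.right_inj hxy)]
    · rw [heR, heL] at hxy
      exact (hy (hφT.1 (h.inter _ _ hxy.symm))).elim
    · rw [heR, heL] at hxy
      exact (hx (hφT.1 (h.inter _ _ hxy))).elim
    · rw [heL, heL] at hxy
      rw [φ.injective (h.left_inj hxy)]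
  have hsurj : Function.Surjective e := by
    intro r
    rcases h.cover r with ⟨x, rfl⟩ | ⟨y, rfl⟩
    · exact ⟨Sum.inl (φ.symm x), by rw [heL, φ.apply_symm_apply]⟩
    · exact ⟨f.inR (ψ.symm y), by rw [heR, ψ.apply_symm_apply]⟩
  have hLL : ∀ x y, R.prec (e (Sum.inl x)) (e (Sum.inl y)) →
      (P₀.glue Q₀ f).prec (Sum.inl x) (Sum.inl y) := fun x y hxy =>
    (glue_prec_inl f _ _).2 (hφ.prec _ _ ((h.left_prec _ _).1 hxy))
  have hprec : ∀ x y, R.prec (e x) (e y) → (P₀.glue Q₀ f).prec x y := by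
    intro x y hxy
    rcases hc x with ⟨x, rfl⟩ | ⟨x, hx, rfl⟩ <;> rcases hc y with ⟨y, rfl⟩ | ⟨y, hy, rfl⟩
    · rw [heR, heR, h.right_prec] at hxy
      exact (glue_prec_inR f _ _).2 (hψ.prec _ _ hxy)
    · rcases f.inR_cases x with ⟨hx, -⟩ | ⟨t, rfl, ht⟩
      · rw [heR, heL] at hxy
        exact (h.not_prec _ _ (mt hφT.1 hy) (mt hψS.1 hx) hxy).elim
      · rw [ht] at hxy ⊢
        exact hLL _ _ hxy
    · rcases f.inR_cases y with ⟨hy, -⟩ | ⟨t, rfl, ht⟩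
      · exact glue_prec_inl_inR f hx hy
      · rw [ht] at hxy ⊢
        exact hLL _ _ hxy
    · exact hLL _ _ hxy
  refine ⟨Equiv.ofBijective e ⟨hinj, hsurj⟩, ⟨?_, ?_, ?_, hprec, ?_⟩, heL, heR⟩
  · change e '' (Sum.inl '' P₀.S) = R.S
    rw [← h.src, ← hφ.src, Set.image_image i φ]
    exact Set.image_image e Sum.inl P₀.S
  · change e '' (f.inR '' Q₀.T) = R.T
    rw [← h.tgt, ← hψ.tgt, Set.image_image j ψ]
    exact (Set.image_image e f.inR Q₀.T).trans (by simp only [heR])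
  · intro x
    rcases hc x with ⟨x, rfl⟩ | ⟨x, hx, rfl⟩
    · exact (congrArg R.label (heR x)).trans
        ((h.right_label _).trans ((hψ.label x).trans (glue_label_inR f x).symm))
    · exact (h.left_label _).trans (hφ.label x)
  · intro x y hxy h₁ h₂
    have hL : ∀ a b, (P₀.glue Q₀ f).event (Sum.inl a) (Sum.inl b) →
        (P₀.glue Q₀ f).Conc (Sum.inl a) (Sum.inl b) →
        R.event (e (Sum.inl a)) (e (Sum.inl b)) := by
      intro a b hab hc
      have hc' : P₀.Conc a b :=
        ⟨mt (glue_prec_inl f _ _).2 hc.1, mt (glue_prec_inl f _ _).2 hc.2⟩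
      exact h.left_event _ _ (hφ.event _ _ (event_of_event_map (Q := P₀.glue Q₀ f) (f := Sum.inl)
        (fun _ _ h _ => glue_event_inl f h) hc' hab) hc'.1 hc'.2)
    change R.event (e x) (e y)
    rcases hc x with ⟨x, rfl⟩ | ⟨x, hx, rfl⟩ <;> rcases hc y with ⟨y, rfl⟩ | ⟨y, hy, rfl⟩
    · have hc' : Q₀.Conc x y :=
        ⟨mt (glue_prec_inR f _ _).2 h₁, mt (glue_prec_inR f _ _).2 h₂⟩
      rw [heR, heR]
      exact h.right_event _ _ (hψ.event _ _ (event_of_event_map (Q := P₀.glue Q₀ f) (f := f.inR)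
        (fun _ _ h _ => glue_event_inR f h) hc' hxy) hc'.1 hc'.2)
    · rcases f.inR_cases x with ⟨hx, -⟩ | ⟨t, rfl, ht⟩
      · exact (h₂ (glue_prec_inl_inR f hy hx)).elim
      · rw [ht] at hxy h₁ h₂ ⊢
        exact hL _ _ hxy ⟨h₁, h₂⟩
    · rcases f.inR_cases y with ⟨hy, -⟩ | ⟨t, rfl, ht⟩
      · exact (h₁ (glue_prec_inl_inR f hx hy)).elim
      · rw [ht] at hxy h₁ h₂ ⊢
        exact hL _ _ hxy ⟨h₁, h₂⟩
    · exact hL _ _ hxy ⟨h₁, h₂⟩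

/-- Monotonicity applied to identities gives a subsumption, and the three clauses defining
precedence in a gluing all hold in `R`. -/
theorem isomorphic (h : IsGluing p q i j) : (P.glue Q (p.matching q)).Isomorphic R := by
  have hid : ∀ P : Iposet α, IsSubsumption P P (Equiv.refl _) := fun P =>
    ⟨by simp, by simp, fun _ => rfl, fun _ _ h => h, fun _ _ h _ _ => h⟩
  obtain ⟨e, he, heL, heR⟩ := h.exists_subsumption (hid P) (hid Q) (p.matching q) (fun t => by
    obtain ⟨k, hk⟩ := p.equiv.surjective t
    rw [← hk]
    simpa [Marking.matching, Marking.emb] using h.glue k)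
  refine ⟨e, he, ?_⟩
  rintro x y (⟨a, b, hab, rfl, rfl⟩ | ⟨a, b, hab, rfl, rfl⟩ | ⟨a, b, ha, hb, rfl, rfl⟩)
  · rw [heL, heL]
    exact (h.left_prec _ _).2 hab
  · rw [heR, heR]
    exact (h.right_prec _ _).2 hab
  · rw [heL, heR]
    exact h.prec _ _ ha hb

end IsGluing

end Iposet

/-! ### Concatenation of step words -/

namespace StepWord

open Iposet

/-- The target interface of the iposet of a step word. -/
noncomputable def tgt : {U W : LoSet α} → (w : StepWord α U W) →
    Marking W w.iposet w.iposet.T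
  | _, _, .nil _ => Marking.univ _ _ _
  | _, _, .up _ _ w => w.tgt.glueRight _
  | _, _, .down _ _ w => w.tgt.glueRight _

/-- The iposet of a concatenation is the gluing of the iposets. -/
theorem exists_isGluing_append {U V W : LoSet α} (w : StepWord α U V) (v : StepWord α V W) :
    ∃ i j, IsGluing (R := (w.append v).iposet) w.tgt v.src i j ∧
      ∀ k, i (w.src.emb k) = (w.append v).src.emb k := by
  induction w with
  | nil U => exact ⟨_, _, .nil v.src, fun _ => rfl⟩
  | up a ha w ih =>
    obtain ⟨i, j, h, hs⟩ := ih v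
    obtain ⟨i', h', hs'⟩ := h.glue_left
      (P₀ := discrete _ (Set.range (Coface.map a)) Set.univ) (Marking.univ _ _ _) w.src
      (w.append v).src hs
    exact ⟨i', _, h', fun k => hs' _⟩
  | @down U V W b hb w ih =>
    obtain ⟨i, j, h, hs⟩ := ih v
    obtain ⟨i', h', hs'⟩ := h.glue_left
      (P₀ := discrete U Set.univ (Set.range (Coface.map b))) (Marking.range b _ _) w.src
      (w.append v).src hs
    exact ⟨i', _, h', fun k => hs' _⟩

theorem append_isomorphic_glue {U V W : LoSet α} (w : StepWord α U V) (v : StepWord α V W) :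
    (w.iposet.glue v.iposet (w.tgt.matching v.src)).Isomorphic (w.append v).iposet := by
  obtain ⟨i, j, h, -⟩ := exists_isGluing_append w v
  exact h.isomorphic

/-- Gluings of iposets subsumed by those of words are subsumed by the iposet of the
concatenation. -/
theorem glue_subsumed_append {U V V' W : LoSet α} (w : StepWord α U V) (v : StepWord α V' W)
    {P Q : Iposet α} (hP : P.Subsumed w.iposet) (hQ : Q.Subsumed v.iposet) (f : Matching P Q) :
    ∃ e : V' = V, (P.glue Q f).Subsumed (w.append (e ▸ v)).iposet := by
  obtain ⟨φ, hφ⟩ := hP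
  obtain ⟨ψ, hψ⟩ := hQ
  have hT : ∀ x, x ∈ P.T ↔ φ x ∈ w.iposet.T := fun x => by
    rw [← hφ.tgt]
    exact φ.injective.mem_set_image.symm
  have hS : ∀ x, x ∈ Q.S ↔ ψ x ∈ v.iposet.S := fun x => by
    rw [← hψ.src]
    exact ψ.injective.mem_set_image.symm
  let eT : P.T ≃ w.iposet.T := φ.subtypeEquiv hT
  let eS : Q.S ≃ v.iposet.S := ψ.subtypeEquiv hS
  have hconc : ∀ x y : P.T, P.Conc x y := fun x y => P.conc_of_T x.2 y.2
  -- Transporting `f` along both subsumptions gives an isomorphism of interfaces, since these are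
  -- concurrent sets. Hence the words can be concatenated, and the transported matching is the
  -- canonical one.
  obtain ⟨rfl, he⟩ := w.tgt.eq_of_iso v.src ((eT.symm.trans f.equiv).trans eS)
    (fun x y hxy => by
      obtain ⟨x, rfl⟩ := eT.surjective x
      obtain ⟨y, rfl⟩ := eT.surjective y
      have h1 : P.event x y := event_of_event_map (f := φ)
        (fun a b hab hc => hφ.event a b hab hc.1 hc.2) (hconc x y) hxy
      have hc := Q.conc_of_S (f.equiv x).2 (f.equiv y).2
      simpa [eS] using hψ.event _ _ ((f.event_iff x y).1 h1) hc.1 hc.2)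
    (fun x => by
      obtain ⟨x, rfl⟩ := eT.surjective x
      have h1 : w.iposet.label (eT x) = P.label x := hφ.label x
      rw [h1, ← f.label_eq]
      simpa [eS] using hψ.label (f.equiv x))
  refine ⟨rfl, ?_⟩
  obtain ⟨i, j, h, -⟩ := exists_isGluing_append w v
  obtain ⟨e, he', -⟩ := h.exists_subsumption hφ hψ f (fun t => by
    obtain ⟨k, hk⟩ := w.tgt.equiv.surjective (eT t)
    have h1 : φ t = w.tgt.emb k := (congrArg Subtype.val hk).symm
    have h2 := he k
    rw [hk] at h2
    have h3 : ψ (f.equiv t) = v.src.emb k := by simpa [eS] using h2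
    rw [h1, h3, h.glue])
  exact ⟨e, he'⟩

end StepWord

/-- The iposet of a path is the iposet of its word. -/
theorem HPath.evAux_eq {X : PrecubicalSet α} {x y : Cell X} (p : HPath X x y) :
    p.evAux = p.word.evAux := by
  induction p with
  | nil x => rfl
  | cons s p ih =>
    cases s with
    | up x y d hd h =>
      exact congrArg (fun E : Σ P : Iposet α, Iposet.Marking _ P P.S =>
        (⟨(Step.up x y d hd h).ev.glue E.1 ((Step.up x y d hd h).tgt.matching E.2),
          (Step.up x y d hd h).src.glue _⟩ : Σ P : Iposet α, Iposet.Marking _ P P.S)) ih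
    | down x y d hd h =>
      exact congrArg (fun E : Σ P : Iposet α, Iposet.Marking _ P P.S =>
        (⟨(Step.down x y d hd h).ev.glue E.1 ((Step.down x y d hd h).tgt.matching E.2),
          (Step.down x y d hd h).src.glue _⟩ : Σ P : Iposet α, Iposet.Marking _ P P.S)) ih

theorem HPath.ev_eq {X : PrecubicalSet α} {x y : Cell X} (p : HPath X x y) :
    p.ev = Ipomset.mk p.word.iposet := by
  rw [HPath.ev, HPath.evAux_eq]

/-! ### Ipomsets, languages and the recognition theorem -/

namespace Ipomset

theorem IsInterval.exists_stepWord {R : Ipomset α} (h : R.IsInterval) :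
    ∃ (U W : LoSet α) (w : StepWord α U W), R = mk w.iposet := by
  induction R using Quotient.inductionOn with
  | h P =>
    obtain ⟨U, W, w, hw⟩ := Iposet.IsInterval.exists_stepWord (P := P) h
    exact ⟨U, W, w, Quotient.sound hw⟩

theorem Subsumed.trans {P Q R : Ipomset α} : P.Subsumed Q → Q.Subsumed R → P.Subsumed R := by
  induction P using Quotient.inductionOn
  induction Q using Quotient.inductionOn
  induction R using Quotient.inductionOn
  exact Iposet.Subsumed.trans

theorem Subsumed.refl (P : Ipomset α) : P.Subsumed P := by
  induction P using Quotient.inductionOn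
  exact ⟨Equiv.refl _, by simp, by simp, fun _ => rfl, fun _ _ h => h, fun _ _ h _ _ => h⟩

end Ipomset

open Ipomset

theorem HDA.mem_lang_iff_exists_word (X : HDA α) (R : Ipomset α) :
    R ∈ X.lang ↔ ∃ (U W : LoSet α) (w : StepWord α U W) (x : X.cells.obj (op U)),
      (⟨U, x⟩ : Cell X.cells) ∈ X.start ∧ Acc X.cells X.accept w x ∧ R = Ipomset.mk w.iposet := by
  constructor
  · rintro ⟨x, hx, y, hy, p, rfl⟩
    exact ⟨x.1, y.1, p.word, x.2, hx, .of_path p hy, p.ev_eq⟩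
  · rintro ⟨U, W, w, x, hx, hw, rfl⟩
    obtain ⟨y, hy, p, rfl⟩ := Acc.exists_path w x hw
    exact ⟨_, hx, _, hy, p, p.ev_eq⟩

/-- The powers of the language of `X` consist of the interval ipomsets subsumed by concatenations
of accepted words. -/
theorem HDA.mem_langPow_iff (X : HDA α) (n : ℕ) : ∀ R : Ipomset α,
    R ∈ langPow X.lang n ↔ R.IsInterval ∧ ∃ (U W : LoSet α) (w : StepWord α U W)
      (x : X.cells.obj (op U)), (⟨U, x⟩ : Cell X.cells) ∈ X.start ∧ PowAcc X n w x ∧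
        R.Subsumed (Ipomset.mk w.iposet) := by
  induction n with
  | zero =>
    intro R
    rw [langPow, HDA.mem_lang_iff_exists_word]
    constructor
    · rintro ⟨U, W, w, x, hx, hw, rfl⟩
      exact ⟨w.isInterval, U, W, w, x, hx, hw, .refl _⟩
    · rintro ⟨hR, U, W, v, x, hx, hv, hRv⟩
      obtain ⟨U', W', w, rfl⟩ := hR.exists_stepWord
      obtain ⟨rfl, h⟩ := (StepWord.subsumed_iff_align w v).1 hRv
      -- The first power involves no down-closure, so here closure of `X.lang` itself under
      -- subsumption is needed.
      exact ⟨_, _, w, x, hx, by simpa using Acc.of_align h x hv, rfl⟩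
  | succ n ih =>
    intro R
    constructor
    · rintro ⟨hR, G, ⟨_, hP, _, hQ, p, q, f, rfl, rfl, rfl⟩, hRG⟩
      refine ⟨hR, ?_⟩
      obtain ⟨U, V, w, x, hx, hw, hpw⟩ := (X.mem_lang_iff_exists_word _).1 hP
      obtain ⟨-, V', W, v, y, hy, hv, hqv⟩ := (ih _).1 hQ
      -- The second factor is only subsumed by a concatenation; monotonicity of gluing absorbs this
      -- into a single subsumption.
      obtain ⟨rfl, h⟩ := StepWord.glue_subsumed_append w v
        (Iposet.Isomorphic.subsumed (Quotient.exact hpw)) hqv f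
      exact ⟨U, W, _, x, hx, ⟨_, w, v, y, rfl, hw, hy, hv⟩, hRG.trans h⟩
    · rintro ⟨hR, U, W, _, x, hx, ⟨V, w, v, y, rfl, hw, hy, hv⟩, hRv⟩
      refine ⟨hR, _, ⟨Ipomset.mk w.iposet, ?_, Ipomset.mk v.iposet, ?_, w.iposet, v.iposet, _, rfl,
        rfl, Quotient.sound (w.append_isomorphic_glue v)⟩, hRv⟩
      · exact (X.mem_lang_iff_exists_word _).2 ⟨U, V, w, x, hx, hw, rfl⟩
      · exact (ih _).2 ⟨v.isInterval, V, W, v, y, hy, hv, .refl _⟩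

theorem HDA.mem_kleenePlus_iff (X : HDA α) (R : Ipomset α) :
    R ∈ kleenePlus X.lang ↔ R.IsInterval ∧ ∃ (U W : LoSet α) (w : StepWord α U W)
      (x : X.cells.obj (op U)) (n : ℕ), (⟨U, x⟩ : Cell X.cells) ∈ X.start ∧ PowAcc X n w x ∧
        R.Subsumed (Ipomset.mk w.iposet) := by
  simp only [kleenePlus, Set.mem_iUnion, HDA.mem_langPow_iff]
  constructor
  · rintro ⟨n, hR, U, W, w, x, hx, hw, h⟩
    exact ⟨hR, U, W, w, x, n, hx, hw, h⟩
  · rintro ⟨hR, U, W, w, x, n, hx, hw, h⟩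
    exact ⟨n, hR, U, W, w, x, hx, hw, h⟩

/-- Both sides are described by words: alignment with a concatenation of accepted words on the left,
subsumption by its iposet on the right. Every interval ipomset being that of a word,
`StepWord.subsumed_iff_align` makes the two agree. -/
theorem HDA.plus_lang (X : HDA α) : X.plus.lang = kleenePlus X.lang := by
  ext R
  rw [HDA.mem_kleenePlus_iff, HDA.mem_lang_iff_exists_word]
  constructor
  · rintro ⟨U, W, w, x, hx, hw, rfl⟩
    obtain ⟨y, V, v, n, hy, hv, h⟩ := (exists_acc_plus_iff w).1 ⟨x, hx, hw⟩
    exact ⟨w.isInterval, U, V, v, y, n, hy, hv, (StepWord.subsumed_iff_align w v).2 ⟨rfl, h⟩⟩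
  · rintro ⟨hR, U, V, v, y, n, hy, hv, hRv⟩
    obtain ⟨U', W', w, rfl⟩ := hR.exists_stepWord
    obtain ⟨rfl, h⟩ := (StepWord.subsumed_iff_align w v).1 hRv
    obtain ⟨x, hx, hw⟩ := (exists_acc_plus_iff w).2 ⟨y, V, v, n, hy, hv, h⟩
    exact ⟨_, _, w, x, hx, hw, rfl⟩

end HDALang

theorem mainTheorem9 {α : Type u} (L : Set (HDALang.Ipomset α)) (hL : HDALang.IsRegular L) :
    HDALang.Ipomset.IsLanguage (HDALang.Ipomset.kleenePlus L) ∧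
      HDALang.IsRegular (HDALang.Ipomset.kleenePlus L) := by
  obtain ⟨X, rfl⟩ := hL
  refine ⟨⟨fun P hP => ((X.mem_kleenePlus_iff P).1 hP).1, fun P Q hP hPQ hQ => ?_⟩,
    X.plus, X.plus_lang⟩
  obtain ⟨-, U, W, w, x, n, hx, hw, h⟩ := (X.mem_kleenePlus_iff Q).1 hQ
  exact (X.mem_kleenePlus_iff P).2 ⟨hP, U, W, w, x, n, hx, hw, hPQ.trans h⟩
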